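/- Let $n\in\{2,3\}$. **Geometry and meshes.** A fractured domain $\Omega\subset\mathbb R^n$ consists of finitely many flat connected subdomains $\Omega_i$ of dimensions $d_i\in\{0,\dots,n\}$ (rock, fractures, intersections), where subdomains of lower dimension have been removed from those of higher dimension. Each side from which a subdomain $\Omega_j$ of dimension $d$ is faced by a subdomain of dimension $d+1$ is an interface $\Gamma_g$ (a copy of $\Omega_j$); $\Gamma$ is the union of the interfaces. The subdomains are connected with each other through the interfaces, and the Dirichlet part $\partial\Omega_D$ of $\partial\Omega$ contains at least one facet of the mesh. Each $\Omega_i$ carries a simplicial mesh which resolves the subdomains of one dimension less and is conforming inside $\Omega_i$; each $\Gamma_g$ carries a simplicial mortar mesh, which need not match its neighbours. The subdomain meshes are shape regular with constant $\sigma$: each element $T$ of positive dimension contains a ball, of the dimension of $T$, of radius $\rho$ with $\operatorname{diam}T\le\sigma\rho$. **Spaces.** $Q_h$ and $\Lambda_h$ are the piecewise constants on the subdomain meshes and on the mortar meshes. $V_h$ is the space of lowest-order Raviart–Thomas fields on the subdomains of positive dimension with continuous normal components on the interior facets and zero normal component on the boundary facets that lie neither on $\Gamma$ nor on $\partial\Omega_D$.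 $V_{0h}\subset V_h$ is the subspace with zero normal component on $\Gamma$, and $W_h=V_{0h}\times\Lambda_h$. $R_h:\Lambda_h\to V_h$ is a linear extension operator: $R_h\mu\cdot\nu$ is on $\Gamma$ the $L^2(\Gamma)$-projection of $\mu$ to the normal traces of $V_h$, and it is zero on all other boundary facets. **Forms.** Let the permeability $K$ be a symmetric positive definite tensor, constant on each subdomain; let the normal permeability $K_\nu$ be bounded above and below by positive constants on each interface, and let the aperture $\gamma>0$ be constant on each interface. For $w=[u_0,\lambda]$, $r=[v_0,\mu]$ in $W_h$ put $u=u_0+R_h\lambda$, $v=v_0+R_h\mu$ and $$a(w,r)=(K^{-1}u,v)_\Omega+(\gamma K_\nu^{-1}\lambda,\mu)_\Gamma,$$ $$a^D(w,r)=\sum_T\sum_{f\subset\partial T}(u\cdot\nu_f)(v\cdot\nu_f)\,(K^{-1}\phi_f,\phi_f)_T+(\gamma K_\nu^{-1}\lambda,\mu)_\Gamma,$$ $$b(r,q)=-(q,\nabla\cdot v+[\![\mu]\!])_\Omega,$$ where $[\![\mu]\!]|_{\Omega_j}=-\sum_g\mu|_{\Gamma_g}$, summed over the interfaces that are sides of $\Omega_j$,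 and $\phi_f$ is the Raviart–Thomas basis function on $T$ with normal component $1$ on the facet $f$ and $0$ on the other facets. Put $\|r\|_a^2=a(r,r)$ and $\|r\|_{a^D}^2=a^D(r,r)$. **Theorem.** There is a unique linear operator $D_h:Q_h\to W_h$ (the discrete gradient) with $a^D(D_hp,r)=b(r,p)$ for all $p\in Q_h$, $r\in W_h$. Let $$\mathcal L(w,p;r,q)=a(w,r)+a^D(D_hp,r)+a^D(D_hq,w),\qquad |||(r,q)|||^2=\|r\|_a^2+\|D_hq\|_{a^D}^2 .$$ Then $$|\mathcal L(w,p;r,q)|\le\alpha\,|||(w,p)|||\;|||(r,q)|||\qquad\text{for all }(w,p),(r,q)\in W_h\times Q_h,$$ $$\inf_{0\ne(r,q)\in W_h\times Q_h}\;\sup_{0\ne(w,p)\in W_h\times Q_h}\frac{\mathcal L(w,p;r,q)}{|||(w,p)|||\;|||(r,q)|||}\ge\beta,$$ where $\beta>0$ depends only on $n$ and $\sigma$, and $\alpha>0$ depends only on $n$, $\sigma$ and an upper bound $\kappa$ for the ratio of the largest to the smallest eigenvalue of $K$ on each subdomain. In particular, for scalar permeabilities ($\kappa=1$) both constants depend only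 on the shape regularity of the mesh, and not on the mesh size, $K$, $K_\nu$ or $\gamma$. -/

import Mathlib

open MeasureTheory
open scoped BigOperators

noncomputable section

namespace MixedDim

/-- The ambient Euclidean space `ℝⁿ`. -/
abbrev E (n : ℕ) := EuclideanSpace ℝ (Fin n)

/-! ### Facets of a simplex and the lowest-order Raviart–Thomas element -/

section Simplex

variable {n d : ℕ}

/-- The facet of `s` opposite to the vertex `k`. -/
def facet (s : Affine.Simplex ℝ (E n) d) (k : Fin (d + 1)) : Set (E n) :=
  convexHull ℝ (s.points '' {k}ᶜ)

/-- Barycentre of a simplex. -/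
def barycentre (s : Affine.Simplex ℝ (E n) d) : E n :=
  Finset.univ.centroid ℝ s.points

/-- Barycentre of the facet opposite to the vertex `k`. -/
def facetBarycentre (s : Affine.Simplex ℝ (E n) d) (k : Fin (d + 1)) : E n :=
  (Finset.univ.erase k).centroid ℝ s.points

/-- The altitude vector: it leads from the vertex `k` to its orthogonal projection on the affine
hull of the opposite facet. -/
def altitudeVec (s : Affine.Simplex ℝ (E n) d) (k : Fin (d + 1)) : E n :=
  (vectorSpan ℝ (s.points '' {k}ᶜ))ᗮ.starProjection (facetBarycentre s k - s.points k)

/-- The height of `s` over the facet `k`. -/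
def height (s : Affine.Simplex ℝ (E n) d) (k : Fin (d + 1)) : ℝ := ‖altitudeVec s k‖

/-- The outer unit normal `ν_f` of the facet `k` (within the affine hull of `s`). -/
def outerNormal (s : Affine.Simplex ℝ (E n) d) (k : Fin (d + 1)) : E n :=
  (height s k)⁻¹ • altitudeVec s k

/-- The `RT₀` basis function `φ_f` of the facet `k`: its normal component is `1` on that facet
and `0` on all the others. -/
def basisField (s : Affine.Simplex ℝ (E n) d) (k : Fin (d + 1)) (x : E n) : E n :=
  (height s k)⁻¹ • (x - s.points k)

/-- The local `RT₀` field `x ↦ a + b (x - x_s)`, `x_s` the barycentre of `s`, given by a vector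
`a` tangential to `s` and a number `b`. -/
def rtField {D : Submodule ℝ (E n)} (s : Affine.Simplex ℝ (E n) d) (v : D × ℝ) (x : E n) : E n :=
  (v.1 : E n) + v.2 • (x - barycentre s)

/-- The divergence, within the `d`-dimensional affine hull of the simplex, of the field
`x ↦ a + b (x - x_s)`. -/
def rtDiv (d : ℕ) {D : Submodule ℝ (E n)} (v : D × ℝ) : ℝ := d * v.2

/-- The normal component `v · ν_f` of a local `RT₀` field on the facet `k`; it is constant on the
facet, and is evaluated at the barycentre of the facet. -/
def rtFlux {D : Submodule ℝ (E n)} (s : Affine.Simplex ℝ (E n) d) (v : D × ℝ) (k : Fin (d + 1)) :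
    ℝ :=
  inner ℝ (rtField s v (facetBarycentre s k)) (outerNormal s k)

theorem rtFlux_add {D : Submodule ℝ (E n)} (s : Affine.Simplex ℝ (E n) d) (v w : D × ℝ)
    (k : Fin (d + 1)) : rtFlux s (v + w) k = rtFlux s v k + rtFlux s w k := by
  simp only [rtFlux, rtField, Prod.fst_add, Prod.snd_add, Submodule.coe_add, add_smul,
    inner_add_left]
  ring

theorem rtFlux_smul {D : Submodule ℝ (E n)} (s : Affine.Simplex ℝ (E n) d) (c : ℝ) (v : D × ℝ)
    (k : Fin (d + 1)) : rtFlux s (c • v) k = c * rtFlux s v k := by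
  simp only [rtFlux, rtField, Prod.smul_fst, Prod.smul_snd, Submodule.coe_smul, smul_eq_mul,
    inner_add_left, inner_smul_left, RCLike.conj_to_real]
  ring

theorem rtFlux_zero {D : Submodule ℝ (E n)} (s : Affine.Simplex ℝ (E n) d)
    (k : Fin (d + 1)) : rtFlux s (0 : D × ℝ) k = 0 := by
  simp [rtFlux, rtField]

end Simplex

/-! ### Mixed-dimensional geometry and its meshes -/

/-- The data of a meshed mixed-dimensional geometry in `ℝⁿ`.

* `Sub` indexes the subdomains `Ω_i^d` of all dimensions, `dim i` is the dimension of the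
  subdomain `i` and `plane i` its affine hull;
* `Cell i` indexes the elements of the mesh of the subdomain `i`;
* `Iface` indexes the interfaces: an interface `g` is the side of the subdomain `lower g` that
  faces the subdomain `upper g` of one dimension more, and `normal g` is the unit normal on it
  that points out of `upper g` (the two sides of a fracture are two interfaces, also when they face
  the same subdomain);
* `MCell g` indexes the elements of the mortar mesh on the interface `g`, which need not match the
  adjacent meshes;
* `bdryD` is the Dirichlet part of the boundary. -/
structure MeshData (n : ℕ) where
  Sub : Type
  [fintypeSub : Fintype Sub]
  dim : Sub → ℕ
  plane : Sub → AffineSubspace ℝ (E n)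
  Cell : Sub → Type
  [fintypeCell : ∀ i, Fintype (Cell i)]
  cell : ∀ i, Cell i → Affine.Simplex ℝ (E n) (dim i)
  Iface : Type
  [fintypeIface : Fintype Iface]
  lower : Iface → Sub
  upper : Iface → Sub
  normal : Iface → E n
  MCell : Iface → Type
  [fintypeMCell : ∀ g, Fintype (MCell g)]
  mcell : ∀ g, MCell g → Affine.Simplex ℝ (E n) (dim (lower g))
  bdryD : Set (E n)

attribute [instance] MeshData.fintypeSub MeshData.fintypeCell MeshData.fintypeIface
  MeshData.fintypeMCell

namespace MeshData

variable {n : ℕ} (M : MeshData n)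

/-- The closed region covered by the mesh of the subdomain `i`. -/
def region (i : M.Sub) : Set (E n) := ⋃ T : M.Cell i, (M.cell i T).closedInterior

/-- The facet `k` of the element `T` lies on a subdomain of one dimension less. -/
def OnGamma (i : M.Sub) (T : M.Cell i) (k : Fin (M.dim i + 1)) : Prop :=
  ∃ j, M.dim j + 1 = M.dim i ∧ facet (M.cell i T) k ⊆ M.region j

/-- The facet `k` of the element `T` of the subdomain `upper g` belongs to the interface `g`. -/
def InIface (g : M.Iface) (T : M.Cell (M.upper g)) (k : Fin (M.dim (M.upper g) + 1)) : Prop :=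
  facet (M.cell _ T) k ⊆ M.region (M.lower g) ∧ outerNormal (M.cell _ T) k = M.normal g

/-- The facet `k` of `T` is an interior facet of the mesh of the subdomain `i`, shared with the
element `T'`, whose facet `k'` it is. Facets on the two sides of a fracture are not identified. -/
def InteriorPair (i : M.Sub) (T : M.Cell i) (k : Fin (M.dim i + 1))
    (T' : M.Cell i) (k' : Fin (M.dim i + 1)) : Prop :=
  0 < M.dim i ∧ T ≠ T' ∧ (M.cell i T).points '' {k}ᶜ = (M.cell i T').points '' {k'}ᶜ ∧
    ¬ M.OnGamma i T k

/-- The facet `k` of `T` is an outer facet: neither interior nor on an interface. -/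
def Outer (i : M.Sub) (T : M.Cell i) (k : Fin (M.dim i + 1)) : Prop :=
  0 < M.dim i ∧ ¬ M.OnGamma i T k ∧ ∀ T' k', ¬ M.InteriorPair i T k T' k'

/-- The outer facet `k` of `T` lies on the Dirichlet boundary. -/
def DirichletFacet (i : M.Sub) (T : M.Cell i) (k : Fin (M.dim i + 1)) : Prop :=
  M.Outer i T k ∧ facet (M.cell i T) k ⊆ M.bdryD

/-- The data `M` describe a mixed-dimensional geometry with triangulated flat subdomains and
mortar meshes on the interfaces. -/
structure IsMesh : Prop where
  cell_nonempty : ∀ i, Nonempty (M.Cell i)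
  /-- Subdomains are flat. -/
  affineSpan_cell : ∀ i T, affineSpan ℝ (Set.range (M.cell i T).points) = M.plane i
  /-- Elements of equal dimension do not overlap. -/
  cell_overlap : ∀ (i j : M.Sub) (T : M.Cell i) (T' : M.Cell j), M.dim i = M.dim j →
    (⟨i, T⟩ : Σ i, M.Cell i) ≠ ⟨j, T'⟩ →
    μHE[M.dim i] ((M.cell i T).closedInterior ∩ (M.cell j T').closedInterior) = 0
  /-- The subdomains of lower dimension have been removed from those of higher dimension. -/
  cell_disjoint : ∀ (i j : M.Sub) (T : M.Cell i), M.dim j < M.dim i →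
    Disjoint (M.cell i T).interior (M.region j)
  /-- Away from the subdomains of lower dimension, two elements of a subdomain meet in a common
  face. -/
  conforming : ∀ (i : M.Sub) (T T' : M.Cell i), T ≠ T' →
    (M.cell i T).closedInterior ∩ (M.cell i T').closedInterior ⊆
      convexHull ℝ (Set.range (M.cell i T).points ∩ Set.range (M.cell i T').points) ∪
        ⋃ j, ⋃ _ : M.dim j < M.dim i, M.region j
  /-- At most two elements share an interior facet. -/
  neighbour_unique : ∀ (i : M.Sub) (T T₁ T₂ : M.Cell i) (k k₁ k₂ : Fin (M.dim i + 1)),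
    M.InteriorPair i T k T₁ k₁ → M.InteriorPair i T k T₂ k₂ → T₁ = T₂
  /-- The meshes resolve the subdomains of one dimension less. -/
  fitted : ∀ (i j : M.Sub) (T : M.Cell i) (k : Fin (M.dim i + 1)), M.dim j + 1 = M.dim i →
    facet (M.cell i T) k ⊆ M.region j ∨ μHE[M.dim j] (facet (M.cell i T) k ∩ M.region j) = 0
  dim_upper : ∀ g, M.dim (M.upper g) = M.dim (M.lower g) + 1
  /-- Every facet on a subdomain of one dimension less belongs to exactly one interface. -/
  iface_complete : ∀ (i j : M.Sub) (T : M.Cell i) (k : Fin (M.dim i + 1)),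
    M.dim j + 1 = M.dim i → facet (M.cell i T) k ⊆ M.region j →
    ∃! g, M.lower g = j ∧ M.upper g = i ∧ M.normal g = outerNormal (M.cell i T) k
  /-- The facets that belong to an interface form a mesh of it. -/
  iface_cover : ∀ g, (⋃ (T) (k) (_ : M.InIface g T k), facet (M.cell _ T) k) = M.region (M.lower g)
  iface_overlap : ∀ g T k T' k', M.InIface g T k → M.InIface g T' k' → (T, k) ≠ (T', k') →
    μHE[M.dim (M.lower g)] (facet (M.cell _ T) k ∩ facet (M.cell _ T') k') = 0
  /-- The mortar elements form a mesh of the interface. -/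
  mortar_cover : ∀ g, (⋃ m, (M.mcell g m).closedInterior) = M.region (M.lower g)
  mortar_overlap : ∀ g m m', m ≠ m' →
    μHE[M.dim (M.lower g)] ((M.mcell g m).closedInterior ∩ (M.mcell g m').closedInterior) = 0
  /-- Every subdomain is connected. -/
  sub_connected : ∀ i (T T' : M.Cell i),
    Relation.ReflTransGen (fun A B => ∃ k k', M.InteriorPair i A k B k') T T'
  /-- The fractured domain is connected. -/
  connected : ∀ i j, Relation.EqvGen (fun i j => ∃ g, M.lower g = i ∧ M.upper g = j) i j
  bdryD_subset : M.bdryD ⊆ frontier (⋃ i, M.region i)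
  /-- The Dirichlet boundary has positive measure. -/
  dirichlet : ∃ i T k, M.DirichletFacet i T k

/-- Every element `T` of the subdomain meshes contains a ball (of its own dimension) of radius
`ρ` with `diam T ≤ σ ρ`. -/
def ShapeRegular (σ : ℝ) : Prop :=
  ∀ (i : M.Sub) (T : M.Cell i), 0 < M.dim i → ∃ c ∈ M.plane i, ∃ ρ : ℝ, 0 < ρ ∧
    Metric.closedBall c ρ ∩ (M.plane i : Set (E n)) ⊆ (M.cell i T).closedInterior ∧
    Metric.diam (M.cell i T).closedInterior ≤ σ * ρ

/-! ### Discrete spaces -/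

/-- Elementwise `RT₀` fields on all the subdomains. -/
abbrev Field := ∀ i : M.Sub, M.Cell i → (M.plane i).direction × ℝ

/-- The normal component of an elementwise `RT₀` field on a facet, from inside the element. -/
def flux (v : M.Field) (i : M.Sub) (T : M.Cell i) (k : Fin (M.dim i + 1)) : ℝ :=
  rtFlux (M.cell i T) (v i T) k

/-- The space `V_h`: `RT₀` fields with continuous normal components that vanish on the outer
facets which are not on the Dirichlet boundary. There is no field on subdomains of dimension
zero. -/
def Vh : Submodule ℝ M.Field where
  carrier := {v | (∀ i, M.dim i = 0 → v i = 0) ∧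
    (∀ i T k T' k', M.InteriorPair i T k T' k' → M.flux v i T k + M.flux v i T' k' = 0) ∧
    (∀ i T k, M.Outer i T k → ¬ M.DirichletFacet i T k → M.flux v i T k = 0)}
  add_mem' := by
    rintro v w ⟨hv0, hv1, hv2⟩ ⟨hw0, hw1, hw2⟩
    refine ⟨fun i hi => ?_, fun i T k T' k' h => ?_, fun i T k h h' => ?_⟩
    · rw [Pi.add_apply, hv0 i hi, hw0 i hi, add_zero]
    · have h1 := hv1 i T k T' k' h
      have h2 := hw1 i T k T' k' h
      simp only [flux, Pi.add_apply, rtFlux_add] at *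
      linarith
    · have h1 := hv2 i T k h h'
      have h2 := hw2 i T k h h'
      simp only [flux, Pi.add_apply, rtFlux_add] at *
      linarith
  zero_mem' := by
    refine ⟨fun i hi => rfl, fun i T k T' k' h => ?_, fun i T k h h' => ?_⟩
    · simp [flux, rtFlux_zero]
    · simp [flux, rtFlux_zero]
  smul_mem' := by
    rintro c v ⟨hv0, hv1, hv2⟩
    refine ⟨fun i hi => ?_, fun i T k T' k' h => ?_, fun i T k h h' => ?_⟩
    · rw [Pi.smul_apply, hv0 i hi, smul_zero]
    · have h1 := hv1 i T k T' k' h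
      simp only [flux, Pi.smul_apply, rtFlux_smul] at *
      rw [← mul_add, h1, mul_zero]
    · have h1 := hv2 i T k h h'
      simp only [flux, Pi.smul_apply, rtFlux_smul] at *
      rw [h1, mul_zero]

/-- The space `V_{0h}`: fields of `V_h` with vanishing normal component on the interfaces. -/
def V0h : Submodule ℝ M.Field where
  carrier := {v | v ∈ M.Vh ∧ ∀ i T k, M.OnGamma i T k → M.flux v i T k = 0}
  add_mem' := by
    rintro v w ⟨hv, hv1⟩ ⟨hw, hw1⟩
    refine ⟨M.Vh.add_mem hv hw, fun i T k h => ?_⟩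
    have h1 := hv1 i T k h
    have h2 := hw1 i T k h
    simp only [flux, Pi.add_apply, rtFlux_add] at *
    linarith
  zero_mem' := ⟨M.Vh.zero_mem, fun i T k h => by simp [flux, rtFlux_zero]⟩
  smul_mem' := by
    rintro c v ⟨hv, hv1⟩
    refine ⟨M.Vh.smul_mem c hv, fun i T k h => ?_⟩
    have h1 := hv1 i T k h
    simp only [flux, Pi.smul_apply, rtFlux_smul] at *
    rw [h1, mul_zero]

/-- The mortar space `Λ_h` of piecewise constants on the mortar meshes. -/
abbrev Lh := ∀ g : M.Iface, M.MCell g → ℝ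

/-- The pressure space `Q_h` of piecewise constants on the subdomain meshes. -/
abbrev Qh := ∀ i : M.Sub, M.Cell i → ℝ

/-- The flux space `W_h = V_{0h} × Λ_h`. -/
abbrev Wh := M.V0h × M.Lh

open Classical in
/-- `(u · ν, v · ν)_Γ`. -/
def traceTrace (u v : M.Field) : ℝ :=
  ∑ g, ∑ T, ∑ k, if M.InIface g T k then
    M.flux u _ T k * M.flux v _ T k * (μHE[M.dim (M.lower g)]).real (facet (M.cell _ T) k) else 0

open Classical in
/-- `(μ, v · ν)_Γ`. -/
def mortarTrace (μ : M.Lh) (v : M.Field) : ℝ :=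
  ∑ g, ∑ T, ∑ k, if M.InIface g T k then
    ∑ m, μ g m * M.flux v _ T k *
      (μHE[M.dim (M.lower g)]).real (facet (M.cell _ T) k ∩ (M.mcell g m).closedInterior) else 0

/-- `R` is a discrete extension operator `R_h : Λ_h → V_h`: the normal component of `R μ` is the
`L²(Γ)`-projection of `μ` to the normal traces of `V_h` on the interfaces, and it is zero on the
rest of the boundary. (Its values on interior facets are not prescribed.) -/
def IsExtension (R : M.Lh →ₗ[ℝ] M.Vh) : Prop :=
  ∀ μ : M.Lh, (∀ v ∈ M.Vh, M.traceTrace (R μ) v = M.mortarTrace μ v) ∧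
    ∀ i T k, M.Outer i T k → M.flux (R μ) i T k = 0

/-- The physical parameters: the permeability tensor `K`, constant on each subdomain and acting
on its tangential vectors; the normal permeability `Kν`, measurable and bounded above and below on
each interface; the aperture `γ`, constant on each interface. -/
structure Params where
  K : M.Sub → E n ≃ₗ[ℝ] E n
  K_symm : ∀ i x y, inner ℝ (K i x) y = inner ℝ x (K i y)
  K_pos : ∀ i x, x ≠ 0 → 0 < inner ℝ (K i x) x
  K_tangential : ∀ i, ∀ x ∈ (M.plane i).direction, K i x ∈ (M.plane i).direction
  Kν : M.Iface → E n → ℝ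
  Kν_measurable : ∀ g, Measurable (Kν g)
  Kν_bounds : ∀ g, ∃ c C : ℝ, 0 < c ∧ ∀ x ∈ M.region (M.lower g), c ≤ Kν g x ∧ Kν g x ≤ C
  γ : M.Iface → ℝ
  γ_pos : ∀ g, 0 < γ g

variable {M}

namespace Params

variable (P : M.Params) (R : M.Lh →ₗ[ℝ] M.Vh)

/-- On each subdomain, the ratio of the largest and the smallest eigenvalue of `K` is at most
`κ`. (For scalar permeabilities this holds with `κ = 1`.) -/
def AnisotropyLE (κ : ℝ) : Prop :=
  ∀ i, ∀ x ∈ (M.plane i).direction, ∀ y ∈ (M.plane i).direction, ‖x‖ = 1 → ‖y‖ = 1 →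
    inner ℝ (P.K i x) x ≤ κ * inner ℝ (P.K i y) y

/-- The total flux `v₀ + R_h μ` of `r = [v₀, μ]`. -/
def total (R : M.Lh →ₗ[ℝ] M.Vh) (r : M.Wh) : M.Field := (r.1 : M.Field) + (R r.2 : M.Field)

/-- `(γ Kν⁻¹ lam, μ)_Γ`. -/
def mortarForm (lam μ : M.Lh) : ℝ :=
  ∑ g, ∑ m, ∫ x in (M.mcell g m).closedInterior,
    P.γ g * (P.Kν g x)⁻¹ * lam g m * μ g m ∂μHE[M.dim (M.lower g)]

/-- The bilinear form `a`. -/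
def a (w r : M.Wh) : ℝ :=
  (∑ i, ∑ T, ∫ x in (M.cell i T).closedInterior,
    inner ℝ ((P.K i).symm (rtField (M.cell i T) (total R w i T) x))
      (rtField (M.cell i T) (total R r i T) x) ∂μHE[M.dim i]) + P.mortarForm w.2 r.2

/-- The lumped bilinear form `a^D`. -/
def aD (w r : M.Wh) : ℝ :=
  (∑ i, ∑ T, ∑ k, M.flux (total R w) i T k * M.flux (total R r) i T k *
    ∫ x in (M.cell i T).closedInterior,
      inner ℝ ((P.K i).symm (basisField (M.cell i T) k x)) (basisField (M.cell i T) k x)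
        ∂μHE[M.dim i]) + P.mortarForm w.2 r.2

end Params

/-- `(q, ⟦μ⟧)_Ω`, where the jump `⟦μ⟧` on a subdomain is minus the sum of the values of `μ` on
all the interfaces of which it is the lower-dimensional side. -/
def jumpPairing (q : M.Qh) (μ : M.Lh) : ℝ :=
  -∑ g, ∑ T, ∑ m, q (M.lower g) T * μ g m *
    (μHE[M.dim (M.lower g)]).real ((M.cell _ T).closedInterior ∩ (M.mcell g m).closedInterior)

/-- The bilinear form `b(r, q) = -(q, D · [v₀ + R_h μ, μ])_Ω`, with
`D · [v, μ] = ∇ · v + ⟦μ⟧`. -/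
def b (R : M.Lh →ₗ[ℝ] M.Vh) (r : M.Wh) (q : M.Qh) : ℝ :=
  -((∑ i, ∑ T, q i T * rtDiv (M.dim i) (Params.total R r i T) *
    (μHE[M.dim i]).real (M.cell i T).closedInterior) + jumpPairing q r.2)

namespace Params

variable (P : M.Params) (R : M.Lh →ₗ[ℝ] M.Vh)

/-- `G` is the discrete gradient `D_h : Q_h → W_h`, that is `a^D(D_h p, r) = b(r, p)`. -/
def IsDiscreteGradient (G : M.Qh →ₗ[ℝ] M.Wh) : Prop :=
  ∀ p r, P.aD R (G p) r = b R r p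

/-- The composite bilinear form `a(w, r) + a^D(D_h p, r) + a^D(D_h q, w)`, where `x = (w, p)` and
`y = (r, q)`. -/
def compositeForm (G : M.Qh →ₗ[ℝ] M.Wh) (x y : M.Wh × M.Qh) : ℝ :=
  P.a R x.1 y.1 + P.aD R (G x.2) y.1 + P.aD R (G y.2) x.1

/-- The weighted norm `(‖r‖_a² + ‖D_h q‖_{a^D}²)^{1/2}` of `y = (r, q)`. -/
def weightedNorm (G : M.Qh →ₗ[ℝ] M.Wh) (y : M.Wh × M.Qh) : ℝ :=
  Real.sqrt (P.a R y.1 y.1 + P.aD R (G y.2) (G y.2))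

end Params

end MeshData

end MixedDim

end

noncomputable section

namespace MixedDim

/-! ### Heights, normals and the lowest-order Raviart–Thomas element on one simplex. -/

section LocalField

variable {n d : ℕ} (s : Affine.Simplex ℝ (E n) d)

/-! The form `aD` is a diagonal lumping of `a`, and the proof rests on comparing the two. On an
element a field is the sum of its fluxes times the basis functions, so Cauchy–Schwarz over the at
most `n + 1` facets gives `a r r ≤ (n + 1) * aD r r` with no assumption on the shape (`a_self_le`).
Conversely, the fluxes are controlled by the L² norm of the field on an inscribed ball and the basis
functions are at most `σ` in size, so `aD r r ≤ C * a r r` with `C` depending on `n`, `σ` and the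
anisotropy `κ` (`aD_self_le`).

Stability needs only the first bound. With `y = D_h q`, the test pair `(r + y/4, -q)` cancels the
mixed term `aD y r` and leaves `a r r + a y r / 4 + aD y y / 4`. Since `n ≤ 3`, `a y y ≤ 4 * aD y
y`, so the remaining cross term is absorbed and the absolute constant `1/16` results (`le_saddle`).
Continuity is Cauchy–Schwarz; the second bound enters because the fluxes are measured in `a`, while
the mixed terms are bounded in `aD` (`abs_saddle_le`).

The form `aD` is definite, since mortar values and fluxes determine an element of `W_h`; hence `D_h`
exists and is unique by finite-dimensional duality (`existsUnique_discreteGradient`).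

The quotient in the inf-sup condition is meaningful only if the weighted norm is definite, that is,
if `D_h q = 0` forces `q = 0` (`eq_zero_of_b_eq_zero`). This is where the topology of the mesh
enters. By the divergence theorem on each element, `b` is a sum of fluxes times positive weights
times pressures. A unit flux through one interior facet makes neighbouring pressures positive
multiples of each other, and a flux through a Dirichlet facet makes a pressure vanish. A flux from
the indicator of an interface balances a positive combination of pressures above it against one
below it; as pressures in one subdomain share their sign, vanishing passes across the interface
(`pressure_iface`). Connectedness then spreads it to the whole domain. -/

theorem facetBarycentre_mem (hd : 0 < d) (k : Fin (d + 1)) :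
    facetBarycentre s k ∈ affineSpan ℝ (s.points '' {k}ᶜ) := by
  have hne : (Finset.univ.erase k).Nonempty := by
    rw [← Finset.card_pos, Finset.card_erase_of_mem (Finset.mem_univ _)]
    simpa using hd
  have hmem := affineCombination_mem_affineSpan_image (k := ℝ) (p := s.points)
    (s := Finset.univ.erase k) (w := Finset.centroidWeights ℝ (Finset.univ.erase k))
    (Finset.sum_centroidWeights_eq_one_of_nonempty ℝ _ hne) (s' := {k}ᶜ)
    (fun i hi hi' => absurd hi' (by simpa using (Finset.mem_erase.1 hi).1))
  exact hmem

theorem facetBarycentre_sub_mem (hd : 0 < d) {k l : Fin (d + 1)} (hkl : l ≠ k) :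
    facetBarycentre s k - s.points l ∈ vectorSpan ℝ (s.points '' {k}ᶜ) := by
  rw [← direction_affineSpan]
  exact AffineSubspace.vsub_mem_direction (facetBarycentre_mem s hd k)
    (subset_affineSpan ℝ _ (Set.mem_image_of_mem _ hkl))

theorem altitudeVec_mem_orthogonal (k : Fin (d + 1)) :
    altitudeVec s k ∈ (vectorSpan ℝ (s.points '' {k}ᶜ))ᗮ :=
  Submodule.starProjection_apply_mem _ _

/-- Otherwise the vertex `k` would lie in the affine span of the opposite facet, against affine
independence. -/
theorem altitudeVec_ne_zero (hd : 0 < d) (k : Fin (d + 1)) : altitudeVec s k ≠ 0 := by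
  intro h
  rw [altitudeVec, Submodule.starProjection_apply_eq_zero_iff,
    Submodule.orthogonal_orthogonal] at h
  have h2 : s.points k ∈ affineSpan ℝ (s.points '' {k}ᶜ) := by
    have h3 := facetBarycentre_mem s hd k
    rw [← direction_affineSpan] at h
    have h4 := AffineSubspace.vadd_mem_of_mem_direction (Submodule.neg_mem _ h) h3
    simp at h4
  have h5 := s.independent.notMem_affineSpan_sdiff k Set.univ
  rw [← Set.compl_eq_univ_sdiff] at h5
  exact h5 h2

theorem height_pos (hd : 0 < d) (k : Fin (d + 1)) : 0 < height s k :=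
  norm_pos_iff.2 (altitudeVec_ne_zero s hd k)

theorem norm_outerNormal (hd : 0 < d) (k : Fin (d + 1)) : ‖outerNormal s k‖ = 1 := by
  have h := height_pos s hd k
  rw [outerNormal, norm_smul, norm_inv, Real.norm_of_nonneg h.le]
  exact inv_mul_cancel₀ h.ne'

theorem inner_outerNormal_of_mem (k : Fin (d + 1)) {x : E n}
    (hx : x ∈ vectorSpan ℝ (s.points '' {k}ᶜ)) : inner ℝ x (outerNormal s k) = 0 := by
  rw [outerNormal, inner_smul_right, (altitudeVec_mem_orthogonal s k) x hx, mul_zero]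

theorem inner_facetBarycentre_sub_self (hd : 0 < d) (k : Fin (d + 1)) :
    inner ℝ (facetBarycentre s k - s.points k) (outerNormal s k) = height s k := by
  have h := height_pos s hd k
  have h1 : inner ℝ (facetBarycentre s k - s.points k) (altitudeVec s k) =
      height s k * height s k := by
    rw [height, ← real_inner_self_eq_norm_mul_norm]
    conv_rhs => rw [altitudeVec, Submodule.inner_starProjection_left_eq_right]
    congr 1
    exact (Submodule.starProjection_eq_self_iff.2 (altitudeVec_mem_orthogonal s k)).symm
  rw [outerNormal, inner_smul_right, h1, inv_mul_cancel_left₀ h.ne']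

theorem inner_points_sub (hd : 0 < d) {k l : Fin (d + 1)} (hkl : l ≠ k) :
    inner ℝ (s.points l - s.points k) (outerNormal s k) = height s k := by
  have h1 := inner_facetBarycentre_sub_self s hd k
  have h2 := inner_outerNormal_of_mem s k (facetBarycentre_sub_mem s hd hkl)
  have h3 : s.points l - s.points k = (facetBarycentre s k - s.points k) -
    (facetBarycentre s k - s.points l) := by abel
  rw [h3, inner_sub_left, h1, h2, sub_zero]

/-- The function is affine, with value `0` at the vertex `k` and `height s k` at all the others: the
simplex lies in a slab of this width. -/
theorem inner_sub_mem_Icc (hd : 0 < d) (k : Fin (d + 1)) {x : E n} (hx : x ∈ s.closedInterior) :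
    0 ≤ inner ℝ (x - s.points k) (outerNormal s k) ∧
      inner ℝ (x - s.points k) (outerNormal s k) ≤ height s k := by
  rw [← Affine.Simplex.convexHull_eq_closedInterior] at hx
  have hconv : Convex ℝ {x : E n | inner ℝ (x - s.points k) (outerNormal s k) ∈
      Set.Icc 0 (height s k)} := by
    have hs : {x : E n | inner ℝ (x - s.points k) (outerNormal s k) ∈ Set.Icc 0 (height s k)} =
        ((innerₗ (E n)).flip (outerNormal s k)) ⁻¹' (Set.Icc
          (inner ℝ (s.points k) (outerNormal s k))
          (height s k + inner ℝ (s.points k) (outerNormal s k))) := by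
      ext x
      simp [inner_sub_left, real_inner_comm x]
    rw [hs]
    exact (convex_Icc _ _).linear_preimage _
  refine convexHull_min ?_ hconv hx
  rintro _ ⟨l, rfl⟩
  have h := height_pos s hd k
  by_cases hl : l = k
  · subst hl; simpa using h.le
  · simpa [inner_points_sub s hd hl] using h.le

variable {A : AffineSubspace ℝ (E n)} (hA : affineSpan ℝ (Set.range s.points) = A)

include hA

theorem mem_plane_of_mem_closedInterior {x : E n} (hx : x ∈ s.closedInterior) : x ∈ A :=
  hA ▸ Affine.Simplex.closedInterior_subset_affineSpan hx

theorem point_mem_plane (k : Fin (d + 1)) : s.points k ∈ A :=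
  mem_plane_of_mem_closedInterior s hA (s.point_mem_closedInterior k)

theorem finrank_direction : Module.finrank ℝ A.direction = d := by
  rw [← hA, direction_affineSpan]
  exact s.independent.finrank_vectorSpan (by simp)

theorem dim_le : d ≤ n := by
  have h := Submodule.finrank_le A.direction
  rwa [finrank_direction s hA, finrank_euclideanSpace_fin] at h

theorem barycentre_mem_plane : barycentre s ∈ A :=
  hA ▸ centroid_mem_affineSpan_of_nonempty ℝ _ Finset.univ_nonempty

theorem facetBarycentre_mem_plane (hd : 0 < d) (k : Fin (d + 1)) : facetBarycentre s k ∈ A :=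
  hA ▸ affineSpan_mono ℝ (Set.image_subset_range _ _) (facetBarycentre_mem s hd k)

theorem outerNormal_mem_direction (hd : 0 < d) (k : Fin (d + 1)) :
    outerNormal s k ∈ A.direction := by
  refine Submodule.smul_mem _ _ ?_
  rw [altitudeVec, Submodule.starProjection_orthogonal_val]
  refine Submodule.sub_mem _ (AffineSubspace.vsub_mem_direction
    (facetBarycentre_mem_plane s hA hd k) (point_mem_plane s hA k)) ?_
  have h := Submodule.starProjection_apply_mem (vectorSpan ℝ (s.points '' {k}ᶜ))
    (facetBarycentre s k - s.points k)
  rw [← hA, direction_affineSpan]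
  exact vectorSpan_mono ℝ (Set.image_subset_range _ _) h

/-- The `RT₀` basis function of the facet `k`, in the form `x ↦ a + b (x - x_s)`. -/
def basisCoeff (k : Fin (d + 1)) : A.direction × ℝ :=
  (⟨(height s k)⁻¹ • (barycentre s - s.points k), Submodule.smul_mem _ _
    (AffineSubspace.vsub_mem_direction (barycentre_mem_plane s hA) (point_mem_plane s hA k))⟩,
    (height s k)⁻¹)

theorem rtField_basisCoeff (k : Fin (d + 1)) (x : E n) :
    rtField s (basisCoeff s hA k) x = basisField s k x := by
  simp only [rtField, basisCoeff, basisField, ← smul_add]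
  congr 1
  abel

theorem rtFlux_basisCoeff (hd : 0 < d) (k l : Fin (d + 1)) :
    rtFlux s (basisCoeff s hA k) l = if l = k then 1 else 0 := by
  rw [rtFlux, rtField_basisCoeff, basisField, inner_smul_left]
  split_ifs with h
  · subst h
    rw [inner_facetBarycentre_sub_self s hd]
    exact inv_mul_cancel₀ (height_pos s hd l).ne'
  · rw [inner_outerNormal_of_mem s l (facetBarycentre_sub_mem s hd (Ne.symm h)), mul_zero]

/-- The `RT₀` field with prescribed normal components. -/
def ofFlux (c : Fin (d + 1) → ℝ) : A.direction × ℝ := ∑ k, c k • basisCoeff s hA k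

omit hA in
/-- The normal components of an `RT₀` field, as a linear map. -/
def fluxMap (D : Submodule ℝ (E n)) : (D × ℝ) →ₗ[ℝ] (Fin (d + 1) → ℝ) where
  toFun v := rtFlux s v
  map_add' v w := funext fun k => rtFlux_add s v w k
  map_smul' c v := funext fun k => rtFlux_smul s c v k

theorem rtFlux_ofFlux (hd : 0 < d) (c : Fin (d + 1) → ℝ) : rtFlux s (ofFlux s hA c) = c := by
  have h : fluxMap s A.direction (ofFlux s hA c) = c := by
    funext l
    rw [ofFlux, map_sum, Finset.sum_apply]
    have h1 : ∀ k, fluxMap s A.direction (c k • basisCoeff s hA k) l =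
        if l = k then c k else 0 := by
      intro k
      rw [map_smul, Pi.smul_apply, smul_eq_mul]
      change c k * rtFlux s (basisCoeff s hA k) l = _
      rw [rtFlux_basisCoeff s hA hd, mul_ite, mul_one, mul_zero]
    simp [h1]
  exact h

/-- A local `RT₀` field is determined by its normal components. -/
theorem rtFlux_injective (hd : 0 < d) :
    Function.Injective (fun v : A.direction × ℝ => rtFlux s v) := by
  have hsurj : Function.Surjective (fluxMap s A.direction) :=
    fun c => ⟨ofFlux s hA c, rtFlux_ofFlux s hA hd c⟩
  -- Both spaces have dimension `d + 1`, so surjectivity is enough.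
  have hfin : Module.finrank ℝ (A.direction × ℝ) = Module.finrank ℝ (Fin (d + 1) → ℝ) := by
    rw [Module.finrank_prod, finrank_direction s hA, Module.finrank_self, Module.finrank_fin_fun]
  exact (LinearMap.injective_iff_surjective_of_finrank_eq_finrank hfin).2 hsurj

theorem ofFlux_rtFlux (hd : 0 < d) (v : A.direction × ℝ) : ofFlux s hA (rtFlux s v) = v :=
  rtFlux_injective s hA hd (rtFlux_ofFlux s hA hd _)

theorem rtField_ofFlux (c : Fin (d + 1) → ℝ) (x : E n) :
    rtField s (ofFlux s hA c) x = ∑ k, c k • basisField s k x := by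
  have h : ∀ v, rtField s v x = ((A.direction.subtype.comp (LinearMap.fst ℝ _ ℝ)) +
      (LinearMap.toSpanSingleton ℝ _ (x - barycentre s)).comp (LinearMap.snd ℝ A.direction ℝ)) v :=
    fun v => rfl
  rw [h, ofFlux, map_sum]
  refine Finset.sum_congr rfl fun k _ => ?_
  rw [map_smul, ← h, rtField_basisCoeff]

theorem rtField_eq_sum (hd : 0 < d) (v : A.direction × ℝ) (x : E n) :
    rtField s v x = ∑ k, rtFlux s v k • basisField s k x := by
  rw [← rtField_ofFlux s hA, ofFlux_rtFlux s hA hd]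

theorem rtDiv_eq_sum (hd : 0 < d) (v : A.direction × ℝ) :
    rtDiv d v = ∑ k, rtFlux s v k * (d / height s k) := by
  conv_lhs => rw [← ofFlux_rtFlux s hA hd v]
  rw [rtDiv, ofFlux, Prod.snd_sum, Finset.mul_sum]
  refine Finset.sum_congr rfl fun k _ => ?_
  simp only [basisCoeff, Prod.smul_mk, smul_eq_mul]
  ring

theorem rtField_mem_direction (v : A.direction × ℝ) {x : E n} (hx : x ∈ A) :
    rtField s v x ∈ A.direction :=
  Submodule.add_mem _ v.1.2 (Submodule.smul_mem _ _
    (AffineSubspace.vsub_mem_direction hx (barycentre_mem_plane s hA)))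

theorem basisField_mem_direction (k : Fin (d + 1)) {x : E n} (hx : x ∈ A) :
    basisField s k x ∈ A.direction := by
  rw [← rtField_basisCoeff s hA]
  exact rtField_mem_direction s hA _ hx

end LocalField

/-! ### L² norms of affine fields on balls. -/

section BallIntegral

variable {D : Type*} [NormedAddCommGroup D] [InnerProductSpace ℝ D] [FiniteDimensional ℝ D]
  [MeasurableSpace D] [BorelSpace D]

theorem volume_real_closedBall_mul (r ρ : ℝ) (hr : 0 ≤ r) (hρ : 0 ≤ ρ) :
    volume.real (Metric.closedBall (0 : D) (r * ρ)) =
      r ^ Module.finrank ℝ D * volume.real (Metric.closedBall (0 : D) ρ) := by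
  have h1 := Measure.addHaar_closedBall (volume : Measure D) 0 (mul_nonneg hr hρ)
  have h2 := Measure.addHaar_closedBall (volume : Measure D) 0 hρ
  rw [measureReal_def, measureReal_def, h1, h2, ENNReal.toReal_mul, ENNReal.toReal_mul,
    ENNReal.toReal_ofReal (by positivity), ENNReal.toReal_ofReal (by positivity), mul_pow,
    mul_assoc]

theorem volume_real_closedBall_pos {ρ : ℝ} (hρ : 0 < ρ) :
    0 < volume.real (Metric.closedBall (0 : D) ρ) :=
  ENNReal.toReal_pos (Metric.measure_closedBall_pos _ _ hρ).ne' measure_closedBall_lt_top.ne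

theorem integrableOn_closedBall {f : D → ℝ} (hf : Continuous f) (ρ : ℝ) :
    IntegrableOn f (Metric.closedBall 0 ρ) :=
  hf.continuousOn.integrableOn_compact (isCompact_closedBall _ _)

/-- The concentric ball of half the radius has at most half the volume, and outside it `‖z‖² ≥
ρ²/4`. -/
theorem le_integral_norm_sq_closedBall (hD : 0 < Module.finrank ℝ D) {ρ : ℝ} (hρ : 0 < ρ) :
    volume.real (Metric.closedBall (0 : D) ρ) * (ρ ^ 2 / 8) ≤
      ∫ z in Metric.closedBall (0 : D) ρ, ‖z‖ ^ 2 := by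
  set B := Metric.closedBall (0 : D) ρ
  set B' := Metric.closedBall (0 : D) (1 / 2 * ρ)
  have hB' : volume.real B' ≤ 1 / 2 * volume.real B := by
    rw [volume_real_closedBall_mul (1 / 2) ρ (by norm_num) hρ.le]
    refine mul_le_mul_of_nonneg_right ?_ measureReal_nonneg
    exact pow_le_of_le_one (by norm_num) (by norm_num) hD.ne'
  have hsub : B' ⊆ B := Metric.closedBall_subset_closedBall (by linarith)
  have hdiff : volume.real (B \ B') = volume.real B - volume.real B' :=
    measureReal_sdiff hsub Metric.isClosed_closedBall.measurableSet
      measure_closedBall_lt_top.ne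
  have hint := integrableOn_closedBall (D := D) (continuous_norm.pow 2) ρ
  have h1 : ∫ z in B \ B', ‖z‖ ^ 2 ≤ ∫ z in B, ‖z‖ ^ 2 :=
    setIntegral_mono_set hint (ae_of_all _ fun z => by positivity)
      (Filter.Eventually.of_forall Set.sdiff_subset)
  have hm : MeasurableSet (B \ B') :=
    measurableSet_closedBall.diff measurableSet_closedBall
  have h2 : ∫ _ in B \ B', (1 / 2 * ρ) ^ 2 ≤ ∫ z in B \ B', ‖z‖ ^ 2 := by
    refine setIntegral_mono_on ?_ (hint.mono_set Set.sdiff_subset) hm ?_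
    · exact integrableOn_const ((measure_mono Set.sdiff_subset).trans_lt
        measure_closedBall_lt_top).ne
    · intro z hz
      have hz' : 1 / 2 * ρ ≤ ‖z‖ := by
        have := hz.2
        rw [mem_closedBall_zero_iff, not_le] at this
        exact this.le
      exact pow_le_pow_left₀ (by positivity) hz' 2
  rw [setIntegral_const, smul_eq_mul, hdiff] at h2
  have hB : 0 ≤ volume.real B := measureReal_nonneg
  nlinarith [sq_nonneg ρ, mul_le_mul_of_nonneg_right hB' (sq_nonneg ρ)]

/-- A lower bound for the `L²` norm of an affine field `z ↦ a + b z` on a ball. -/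
theorem le_integral_affine_closedBall (hD : 0 < Module.finrank ℝ D) {ρ : ℝ} (hρ : 0 < ρ)
    (a : D) (b : ℝ) :
    volume.real (Metric.closedBall (0 : D) ρ) * (‖a‖ ^ 2 + b ^ 2 * (ρ ^ 2 / 8)) ≤
      ∫ z in Metric.closedBall (0 : D) ρ, ‖a + b • z‖ ^ 2 := by
  set B := Metric.closedBall (0 : D) ρ
  -- Averaging over the reflection `z ↦ -z` removes the cross term, by the parallelogram law.
  have hneg : ∫ z in B, ‖a + b • z‖ ^ 2 = ∫ z in B, ‖a - b • z‖ ^ 2 := by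
    have h := (Measure.measurePreserving_neg (volume : Measure D)).setIntegral_preimage_emb
      (MeasurableEquiv.neg D).measurableEmbedding (fun z => ‖a + b • z‖ ^ 2) B
    have hpre : Neg.neg ⁻¹' B = B := by ext z; simp [B]
    rw [hpre] at h
    rw [← h]
    simp [sub_eq_add_neg]
  have hi1 := integrableOn_closedBall (D := D) (f := fun z => ‖a + b • z‖ ^ 2) (by fun_prop) ρ
  have hi2 := integrableOn_closedBall (D := D) (f := fun z => ‖a - b • z‖ ^ 2) (by fun_prop) ρ
  have hi3 := integrableOn_closedBall (D := D) (f := fun z => ‖z‖ ^ 2) (by fun_prop) ρ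
  have hsum : 2 * ∫ z in B, ‖a + b • z‖ ^ 2 =
      2 * (volume.real B * ‖a‖ ^ 2 + b ^ 2 * ∫ z in B, ‖z‖ ^ 2) := by
    have h1 : 2 * ∫ z in B, ‖a + b • z‖ ^ 2 = ∫ z in B, (‖a + b • z‖ ^ 2 + ‖a - b • z‖ ^ 2) := by
      rw [integral_add hi1 hi2, ← hneg]; ring
    have h2 : ∀ z : D, ‖a + b • z‖ ^ 2 + ‖a - b • z‖ ^ 2 = 2 * ‖a‖ ^ 2 + 2 * b ^ 2 * ‖z‖ ^ 2 := by
      intro z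
      have h := parallelogram_law_with_norm ℝ a (b • z)
      rw [norm_smul, Real.norm_eq_abs] at h
      have hb : |b| * |b| = b ^ 2 := by rw [abs_mul_abs_self, sq]
      nlinarith [h, hb]
    rw [h1]
    simp_rw [h2]
    have hi0 : IntegrableOn (fun _ : D => 2 * ‖a‖ ^ 2) B :=
      integrableOn_const measure_closedBall_lt_top.ne
    rw [integral_add hi0 (hi3.const_mul _), setIntegral_const, integral_const_mul, smul_eq_mul]
    ring
  have h3 := le_integral_norm_sq_closedBall hD hρ
  nlinarith [mul_le_mul_of_nonneg_left h3 (sq_nonneg b)]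

end BallIntegral

/-! ### Hausdorff measure on flat pieces, transported to the direction space. -/

section Measure

variable {n d : ℕ} (s : Affine.Simplex ℝ (E n) d)

variable {A : AffineSubspace ℝ (E n)} (hA : affineSpan ℝ (Set.range s.points) = A)

/-- The isometric chart `z ↦ z + c` of an affine subspace. -/
def chart (A : AffineSubspace ℝ (E n)) (c : E n) (z : A.direction) : E n := (z : E n) + c

theorem isometry_chart (c : E n) : Isometry (chart A c) :=
  (isometry_add_right c).comp isometry_subtype_coe

theorem range_chart {c : E n} (hc : c ∈ A) : Set.range (chart A c) = A := by
  ext x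
  constructor
  · rintro ⟨z, rfl⟩
    exact AffineSubspace.vadd_mem_of_mem_direction z.2 hc
  · intro hx
    exact ⟨⟨x - c, AffineSubspace.vsub_mem_direction hx hc⟩, sub_add_cancel x c⟩

include hA

/-- Isometries preserve the normalised Hausdorff measure, which is the volume on a `d`-dimensional
inner product space. -/
theorem map_chart {c : E n} (hc : c ∈ A) :
    (volume : Measure A.direction).map (chart A c) = (μHE[d]).restrict (A : Set (E n)) := by
  rw [← range_chart hc, ← (isometry_chart c).map_euclideanHausdorffMeasure]
  congr 1
  have h := InnerProductSpace.euclideanHausdorffMeasure_eq_volume (V := A.direction)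
  rw [finrank_direction s hA] at h
  exact h.symm

theorem setIntegral_chart {c : E n} (hc : c ∈ A) {S : Set (E n)} (hS : S ⊆ A)
    (f : E n → ℝ) :
    ∫ x in S, f x ∂μHE[d] = ∫ z in chart A c ⁻¹' S, f (chart A c z) := by
  rw [← ((isometry_chart c).isClosedEmbedding.measurableEmbedding).setIntegral_map,
    map_chart s hA hc, Measure.restrict_restrict_of_subset hS]

theorem measure_chart {c : E n} (hc : c ∈ A) {S : Set (E n)} (hS : S ⊆ A) :
    μHE[d] S = volume (chart A c ⁻¹' S) := by
  rw [← ((isometry_chart c).isClosedEmbedding.measurableEmbedding).map_apply,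
    map_chart s hA hc, Measure.restrict_eq_self _ hS]

theorem measure_lt_top_of_isCompact {S : Set (E n)} (hS : S ⊆ A) (hS' : IsCompact S) :
    μHE[d] S < ⊤ := by
  have hc := point_mem_plane s hA 0
  rw [measure_chart s hA hc hS]
  exact ((isometry_chart _).isClosedEmbedding.isCompact_preimage hS').measure_lt_top

omit hA in
theorem measure_closedInterior_lt_top : μHE[d] s.closedInterior < ⊤ :=
  measure_lt_top_of_isCompact s rfl Affine.Simplex.closedInterior_subset_affineSpan
    s.isCompact_closedInterior

omit hA in
theorem integrableOn_closedInterior {f : E n → ℝ} (hf : Continuous f) :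
    IntegrableOn f s.closedInterior μHE[d] := by
  obtain ⟨C, hC⟩ := s.isCompact_closedInterior.exists_bound_of_continuousOn hf.continuousOn
  exact Measure.integrableOn_of_bounded (measure_closedInterior_lt_top s).ne
    hf.aestronglyMeasurable (ae_restrict_of_forall_mem s.isClosed_closedInterior.measurableSet hC)

omit hA in
theorem preimage_ball_subset {c : E n} {ρ : ℝ} {S : Set (E n)} (hc : c ∈ A)
    (h : Metric.closedBall c ρ ∩ A ⊆ S) : Metric.closedBall 0 ρ ⊆ chart A c ⁻¹' S := by
  intro z hz
  refine h ⟨?_, AffineSubspace.vadd_mem_of_mem_direction z.2 hc⟩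
  rw [mem_closedBall_zero_iff] at hz
  simpa [chart] using hz

omit hA in
-- A nonempty convex set in finite dimension has an intrinsic interior point. This serves for
-- positivity statements where no shape regularity is available, as on mortar elements and facets.
theorem exists_ball_subset_closedInterior : ∃ c ∈ affineSpan ℝ (Set.range s.points), ∃ ρ : ℝ,
    0 < ρ ∧ Metric.closedBall c ρ ∩ affineSpan ℝ (Set.range s.points) ⊆ s.closedInterior := by
  have hconv : Convex ℝ s.closedInterior := by
    rw [← Affine.Simplex.convexHull_eq_closedInterior]; exact convex_convexHull _ _
  have hspan : affineSpan ℝ s.closedInterior = affineSpan ℝ (Set.range s.points) := by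
    rw [← Affine.Simplex.convexHull_eq_closedInterior, affineSpan_convexHull]
  obtain ⟨_, y, hy, rfl⟩ := s.nonempty_closedInterior.intrinsicInterior hconv
  rw [mem_interior_iff_mem_nhds, Metric.nhds_basis_closedBall.mem_iff] at hy
  obtain ⟨ρ, hρ, hball⟩ := hy
  refine ⟨y, hspan ▸ y.2, ρ, hρ, ?_⟩
  rintro x ⟨hx, hx'⟩
  have hx'' : x ∈ affineSpan ℝ s.closedInterior := hspan ▸ hx'
  exact hball (a := ⟨x, hx''⟩) hx

omit hA in
theorem measure_closedInterior_pos : 0 < μHE[d] s.closedInterior := by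
  obtain ⟨c, hc, ρ, hρ, h⟩ := exists_ball_subset_closedInterior s
  rw [measure_chart s rfl hc Affine.Simplex.closedInterior_subset_affineSpan]
  exact (Metric.measure_closedBall_pos _ _ hρ).trans_le
    (measure_mono (preimage_ball_subset hc h))

omit hA in
theorem measureReal_closedInterior_pos : 0 < (μHE[d]).real s.closedInterior :=
  ENNReal.toReal_pos (measure_closedInterior_pos s).ne' (measure_closedInterior_lt_top s).ne

omit hA in
theorem facet_eq_closedInterior {d : ℕ} (s : Affine.Simplex ℝ (E n) (d + 1)) (k : Fin (d + 1 + 1)) :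
    facet s k = (s.faceOpposite k).closedInterior := by
  rw [facet, ← Affine.Simplex.convexHull_eq_closedInterior, s.range_faceOpposite_points]

omit hA in
theorem measure_facet_pos {d' : ℕ} (hd : d = d' + 1) (k : Fin (d + 1)) :
    0 < μHE[d'] (facet s k) := by
  subst hd
  rw [facet_eq_closedInterior]
  exact measure_closedInterior_pos (s.faceOpposite k)

omit hA in
theorem measure_facet_lt_top {d' : ℕ} (hd : d = d' + 1) (k : Fin (d + 1)) :
    μHE[d'] (facet s k) < ⊤ := by
  subst hd
  rw [facet_eq_closedInterior]
  exact measure_closedInterior_lt_top (s.faceOpposite k)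

end Measure

/-! ### Scaling estimates on shape regular elements. -/

section Scaling

variable {n d : ℕ} (s : Affine.Simplex ℝ (E n) d)
  {A : AffineSubspace ℝ (E n)} (hA : affineSpan ℝ (Set.range s.points) = A)
  {c : E n} {ρ σ : ℝ}

omit hA in
theorem norm_sub_le_diam {x y : E n} (hx : x ∈ s.closedInterior) (hy : y ∈ s.closedInterior)
    (hdiam : Metric.diam s.closedInterior ≤ σ * ρ) : ‖x - y‖ ≤ σ * ρ := by
  rw [← dist_eq_norm]
  exact (Metric.dist_le_diam_of_mem s.isCompact_closedInterior.isBounded hx hy).trans hdiam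

omit hA in
theorem facetBarycentre_mem_closedInterior (hd : 0 < d) (k : Fin (d + 1)) :
    facetBarycentre s k ∈ s.closedInterior := by
  have hne : (Finset.univ.erase k).Nonempty := by
    rw [← Finset.card_pos, Finset.card_erase_of_mem (Finset.mem_univ _)]
    simpa using hd
  rw [← Affine.Simplex.convexHull_eq_closedInterior]
  exact affineCombination_mem_convexHull (fun _ _ => by simp [Finset.centroidWeights])
    (Finset.sum_centroidWeights_eq_one_of_nonempty ℝ _ hne)

include hA

/-- Both `c` and `c + ρ ν` lie in the slab of width `height s k` that contains the simplex. -/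
theorem le_height (hd : 0 < d) (hc : c ∈ A) (hρ : 0 < ρ)
    (hball : Metric.closedBall c ρ ∩ A ⊆ s.closedInterior) (k : Fin (d + 1)) :
    ρ ≤ height s k := by
  have hν := norm_outerNormal s hd k
  have h1 : c ∈ s.closedInterior := hball ⟨Metric.mem_closedBall_self hρ.le, hc⟩
  have h2 : ρ • outerNormal s k + c ∈ s.closedInterior := by
    refine hball ⟨?_, AffineSubspace.vadd_mem_of_mem_direction
      (Submodule.smul_mem _ _ (outerNormal_mem_direction s hA hd k)) hc⟩
    simp [norm_smul, hν, abs_of_pos hρ]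
  have h3 := (inner_sub_mem_Icc s hd k h1).1
  have h4 := (inner_sub_mem_Icc s hd k h2).2
  rw [add_sub_assoc, inner_add_left, inner_smul_left, real_inner_self_eq_norm_sq, hν] at h4
  simp only [conj_trivial] at h4
  linarith

/-- The normal components of an `RT₀` field are bounded by its `L²` norm. -/
theorem rtFlux_sq_le (hd : 0 < d) (hc : c ∈ A) (hρ : 0 < ρ)
    (hball : Metric.closedBall c ρ ∩ A ⊆ s.closedInterior)
    (hdiam : Metric.diam s.closedInterior ≤ σ * ρ) (v : A.direction × ℝ) (k : Fin (d + 1)) :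
    rtFlux s v k ^ 2 * volume.real (Metric.closedBall (0 : A.direction) ρ) ≤
      (2 + 16 * σ ^ 2) * ∫ x in s.closedInterior, ‖rtField s v x‖ ^ 2 ∂μHE[d] := by
  have hT : s.closedInterior ⊆ A := fun x hx => mem_plane_of_mem_closedInterior s hA hx
  have hcT : c ∈ s.closedInterior := hball ⟨Metric.mem_closedBall_self hρ.le, hc⟩
  -- The field is recentred at the centre `c` of the ball, where the ball estimate applies.
  set a : A.direction := ⟨rtField s v c, rtField_mem_direction s hA v hc⟩ with ha
  have hfield : ∀ z : A.direction, ‖rtField s v (chart A c z)‖ = ‖a + v.2 • z‖ := by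
    intro z
    rw [← Submodule.norm_coe (a + v.2 • z)]
    congr 1
    simp only [rtField, chart, ha, Submodule.coe_add, Submodule.coe_smul, smul_sub, smul_add]
    abel
  have hcont : Continuous fun z : A.direction => ‖a + v.2 • z‖ ^ 2 := by fun_prop
  have hI : volume.real (Metric.closedBall (0 : A.direction) ρ) *
      (‖a‖ ^ 2 + v.2 ^ 2 * (ρ ^ 2 / 8)) ≤
      ∫ x in s.closedInterior, ‖rtField s v x‖ ^ 2 ∂μHE[d] := by
    rw [setIntegral_chart s hA hc hT]
    simp_rw [hfield]
    refine (le_integral_affine_closedBall (by rwa [finrank_direction s hA]) hρ a v.2).trans ?_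
    refine setIntegral_mono_set (hcont.continuousOn.integrableOn_compact
      ((isometry_chart _).isClosedEmbedding.isCompact_preimage s.isCompact_closedInterior))
      (ae_of_all _ fun z => by positivity)
      (Filter.Eventually.of_forall (preimage_ball_subset hc hball))
  have hflux : |rtFlux s v k| ≤ ‖a‖ + |v.2| * (σ * ρ) := by
    have h1 : rtField s v (facetBarycentre s k) = (a : E n) + v.2 • (facetBarycentre s k - c) := by
      simp only [rtField, ha, smul_sub]
      abel
    refine (abs_real_inner_le_norm _ _).trans ?_
    rw [norm_outerNormal s hd, mul_one, h1]
    refine (norm_add_le _ _).trans ?_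
    rw [norm_smul, Real.norm_eq_abs]
    gcongr
    · exact le_of_eq rfl
    · exact norm_sub_le_diam s (facetBarycentre_mem_closedInterior s hd k) hcT hdiam
  -- From `(x + y)² ≤ 2x² + 2y²`; the `16` offsets the `1/8` of the ball estimate.
  have hsq : rtFlux s v k ^ 2 ≤ (2 + 16 * σ ^ 2) * (‖a‖ ^ 2 + v.2 ^ 2 * (ρ ^ 2 / 8)) := by
    have h1 : rtFlux s v k ^ 2 ≤ (‖a‖ + |v.2| * (σ * ρ)) ^ 2 := by
      rw [← sq_abs]
      exact pow_le_pow_left₀ (abs_nonneg _) hflux 2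
    have h2 : (|v.2| * (σ * ρ)) ^ 2 = v.2 ^ 2 * σ ^ 2 * ρ ^ 2 := by
      rw [mul_pow, sq_abs, mul_pow]; ring
    nlinarith [sq_nonneg (‖a‖ - |v.2| * (σ * ρ)), mul_nonneg (sq_nonneg σ) (sq_nonneg ‖a‖),
      mul_nonneg (sq_nonneg v.2) (sq_nonneg ρ)]
  have hV : 0 ≤ volume.real (Metric.closedBall (0 : A.direction) ρ) := measureReal_nonneg
  calc _ ≤ (2 + 16 * σ ^ 2) * (‖a‖ ^ 2 + v.2 ^ 2 * (ρ ^ 2 / 8)) *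
        volume.real (Metric.closedBall (0 : A.direction) ρ) := by gcongr
    _ = (2 + 16 * σ ^ 2) * (volume.real (Metric.closedBall (0 : A.direction) ρ) *
        (‖a‖ ^ 2 + v.2 ^ 2 * (ρ ^ 2 / 8))) := by ring
    _ ≤ _ := by gcongr

/-- The `L²` norm of the `RT₀` basis functions. -/
theorem integral_basisField_le (hd : 0 < d) (hc : c ∈ A) (hρ : 0 < ρ) (hσ : 0 ≤ σ)
    (hball : Metric.closedBall c ρ ∩ A ⊆ s.closedInterior)
    (hdiam : Metric.diam s.closedInterior ≤ σ * ρ) (k : Fin (d + 1)) :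
    ∫ x in s.closedInterior, ‖basisField s k x‖ ^ 2 ∂μHE[d] ≤
      σ ^ (d + 2) * volume.real (Metric.closedBall (0 : A.direction) ρ) := by
  have hT : s.closedInterior ⊆ A := fun x hx => mem_plane_of_mem_closedInterior s hA hx
  have hcT : c ∈ s.closedInterior := hball ⟨Metric.mem_closedBall_self hρ.le, hc⟩
  have hh := le_height s hA hd hc hρ hball k
  have hvol : (μHE[d]).real s.closedInterior ≤
      σ ^ d * volume.real (Metric.closedBall (0 : A.direction) ρ) := by
    have hsub : chart A c ⁻¹' s.closedInterior ⊆ Metric.closedBall 0 (σ * ρ) := by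
      intro z hz
      have h := norm_sub_le_diam s hz hcT hdiam
      rw [mem_closedBall_zero_iff]
      simpa [chart] using h
    have h := measureReal_mono (μ := volume) hsub measure_closedBall_lt_top.ne
    rw [volume_real_closedBall_mul σ ρ hσ hρ.le, finrank_direction s hA] at h
    rwa [measureReal_def, measure_chart s hA hc hT]
  -- The numerator is at most the diameter, hence `σ ρ`, and the height is at least `ρ`.
  have hpt : ∀ x ∈ s.closedInterior, ‖basisField s k x‖ ^ 2 ≤ σ ^ 2 := by
    intro x hx
    refine pow_le_pow_left₀ (norm_nonneg _) ?_ 2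
    have h1 := norm_sub_le_diam s hx (s.point_mem_closedInterior k) hdiam
    rw [basisField, norm_smul, norm_inv, Real.norm_of_nonneg (hρ.trans_le hh).le, inv_mul_le_iff₀
      (hρ.trans_le hh), mul_comm]
    exact h1.trans (by gcongr)
  have hcont : Continuous fun x => ‖basisField s k x‖ ^ 2 := by unfold basisField; fun_prop
  have h := setIntegral_mono_on (integrableOn_closedInterior s hcont)
    (integrableOn_const (measure_closedInterior_lt_top s).ne)
    s.isClosed_closedInterior.measurableSet hpt
  rw [setIntegral_const, smul_eq_mul] at h
  calc _ ≤ (μHE[d]).real s.closedInterior * σ ^ 2 := h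
    _ ≤ σ ^ d * volume.real (Metric.closedBall (0 : A.direction) ρ) * σ ^ 2 := by gcongr
    _ = _ := by ring

end Scaling

/-! ### Local comparison of the mass form and the lumped form. -/

section QuadraticForm

variable {n : ℕ} {L : E n →ₗ[ℝ] E n}

/-- Semidefiniteness on `y k - y l` bounds each mixed term by the mean of two diagonal ones; summing
over all pairs produces the cardinality. -/
theorem inner_map_sum_le (hsymm : ∀ x y, inner ℝ (L x) y = inner ℝ x (L y))
    (hpos : ∀ x, 0 ≤ inner ℝ (L x) x) {ι : Type*} [Fintype ι] (y : ι → E n) :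
    inner ℝ (L (∑ k, y k)) (∑ k, y k) ≤ Fintype.card ι * ∑ k, inner ℝ (L (y k)) (y k) := by
  have h1 : ∀ k l, inner ℝ (L (y k)) (y l) ≤
      1 / 2 * inner ℝ (L (y k)) (y k) + 1 / 2 * inner ℝ (L (y l)) (y l) := by
    intro k l
    have h := hpos (y k - y l)
    rw [map_sub, inner_sub_left, inner_sub_right, inner_sub_right, hsymm (y l) (y k),
      real_inner_comm (y l)] at h
    linarith [real_inner_comm (L (y k)) (y l)]
  rw [map_sum, sum_inner]
  simp_rw [inner_sum]
  refine (Finset.sum_le_sum fun k _ => Finset.sum_le_sum fun l _ => h1 k l).trans ?_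
  simp only [Finset.sum_add_distrib, Finset.sum_const, Finset.card_univ, nsmul_eq_mul,
    ← Finset.mul_sum]
  apply le_of_eq
  ring

end QuadraticForm

section LocalForm

variable {n d : ℕ} (s : Affine.Simplex ℝ (E n) d) (L : E n →ₗ[ℝ] E n) {D : Submodule ℝ (E n)}

/-- `(L v, w)_s` for `RT₀` fields `v`, `w` on a simplex `s`. -/
def massForm (v w : D × ℝ) : ℝ :=
  ∫ x in s.closedInterior, inner ℝ (L (rtField s v x)) (rtField s w x) ∂μHE[d]

/-- `(L φ_k, φ_k)_s` for an `RT₀` basis function `φ_k`. -/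
def lumpedWeight (k : Fin (d + 1)) : ℝ :=
  ∫ x in s.closedInterior, inner ℝ (L (basisField s k x)) (basisField s k x) ∂μHE[d]

theorem continuous_rtField (v : D × ℝ) : Continuous (rtField s v) := by
  unfold rtField; fun_prop

theorem continuous_basisField (k : Fin (d + 1)) : Continuous (basisField s k) := by
  unfold basisField; fun_prop

theorem rtField_add (v w : D × ℝ) (x : E n) :
    rtField s (v + w) x = rtField s v x + rtField s w x := by
  simp only [rtField, Prod.fst_add, Prod.snd_add, Submodule.coe_add, add_smul]
  abel

theorem rtField_smul (c : ℝ) (v : D × ℝ) (x : E n) :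
    rtField s (c • v) x = c • rtField s v x := by
  simp only [rtField, Prod.smul_fst, Prod.smul_snd, Submodule.coe_smul, smul_eq_mul, mul_smul,
    smul_add]

theorem integrableOn_inner {f g : E n → E n} (hf : Continuous f) (hg : Continuous g) :
    IntegrableOn (fun x => inner ℝ (L (f x)) (g x)) s.closedInterior μHE[d] :=
  integrableOn_closedInterior s
    ((L.continuous_of_finiteDimensional.comp hf).inner hg)

theorem massForm_add_left (v v' w : D × ℝ) :
    massForm s L (v + v') w = massForm s L v w + massForm s L v' w := by
  unfold massForm
  simp_rw [rtField_add, map_add, inner_add_left]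
  exact integral_add
    (integrableOn_inner s L (continuous_rtField s v) (continuous_rtField s w))
    (integrableOn_inner s L (continuous_rtField s v') (continuous_rtField s w))

theorem massForm_smul_left (c : ℝ) (v w : D × ℝ) :
    massForm s L (c • v) w = c * massForm s L v w := by
  unfold massForm
  simp_rw [rtField_smul, map_smul, inner_smul_left]
  exact integral_const_mul _ _

variable {L}

theorem massForm_comm (hsymm : ∀ x y, inner ℝ (L x) y = inner ℝ x (L y)) (v w : D × ℝ) :
    massForm s L v w = massForm s L w v := by
  unfold massForm
  congr 1
  ext x
  rw [hsymm, real_inner_comm]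

theorem massForm_self_nonneg (hpos : ∀ x, 0 ≤ inner ℝ (L x) x) (v : D × ℝ) :
    0 ≤ massForm s L v v :=
  integral_nonneg fun _ => hpos _

theorem lumpedWeight_nonneg (hpos : ∀ x, 0 ≤ inner ℝ (L x) x) (k : Fin (d + 1)) :
    0 ≤ lumpedWeight s L k :=
  integral_nonneg fun _ => hpos _

variable {A : AffineSubspace ℝ (E n)} (hA : affineSpan ℝ (Set.range s.points) = A)

include hA

/-- The mass form is bounded by the lumped form. -/
theorem massForm_self_le (hd : 0 < d) (hsymm : ∀ x y, inner ℝ (L x) y = inner ℝ x (L y))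
    (hpos : ∀ x, 0 ≤ inner ℝ (L x) x) (v : A.direction × ℝ) :
    massForm s L v v ≤ (d + 1) * ∑ k, rtFlux s v k * rtFlux s v k * lumpedWeight s L k := by
  have hint : ∀ k, IntegrableOn (fun x => rtFlux s v k * rtFlux s v k *
      inner ℝ (L (basisField s k x)) (basisField s k x)) s.closedInterior μHE[d] := fun k =>
    (integrableOn_inner s L (continuous_basisField s k) (continuous_basisField s k)).const_mul _
  have hR : (d + 1 : ℝ) * ∑ k, rtFlux s v k * rtFlux s v k * lumpedWeight s L k =
      ∫ x in s.closedInterior, (d + 1) * ∑ k, rtFlux s v k * rtFlux s v k *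
        inner ℝ (L (basisField s k x)) (basisField s k x) ∂μHE[d] := by
    rw [integral_const_mul, integral_finsetSum _ fun k _ => hint k]
    simp_rw [integral_const_mul]
    rfl
  rw [hR]
  refine integral_mono
    (integrableOn_inner s L (continuous_rtField s v) (continuous_rtField s v))
    ((integrable_finsetSum _ fun k _ => hint k).const_mul _) fun x => ?_
  have h := inner_map_sum_le hsymm hpos fun k => rtFlux s v k • basisField s k x
  rw [← rtField_eq_sum s hA hd, Fintype.card_fin] at h
  refine h.trans (le_of_eq ?_)
  push_cast
  congr 1
  refine Finset.sum_congr rfl fun k _ => ?_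
  rw [map_smul, inner_smul_left, inner_smul_right]
  simp only [conj_trivial]
  ring

theorem le_massForm {m : ℝ} (hm : ∀ x ∈ A.direction, m * ‖x‖ ^ 2 ≤ inner ℝ (L x) x)
    (v : A.direction × ℝ) :
    m * ∫ x in s.closedInterior, ‖rtField s v x‖ ^ 2 ∂μHE[d] ≤ massForm s L v v := by
  rw [← integral_const_mul]
  exact setIntegral_mono_on
    ((integrableOn_closedInterior s ((continuous_rtField s v).norm.pow 2)).const_mul _)
    (integrableOn_inner s L (continuous_rtField s v) (continuous_rtField s v))
    s.isClosed_closedInterior.measurableSet fun x hx =>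
      hm _ (rtField_mem_direction s hA v (mem_plane_of_mem_closedInterior s hA hx))

theorem lumpedWeight_le {m : ℝ} (hm : ∀ x ∈ A.direction, inner ℝ (L x) x ≤ m * ‖x‖ ^ 2)
    (k : Fin (d + 1)) :
    lumpedWeight s L k ≤ m * ∫ x in s.closedInterior, ‖basisField s k x‖ ^ 2 ∂μHE[d] := by
  rw [← integral_const_mul]
  exact setIntegral_mono_on
    (integrableOn_inner s L (continuous_basisField s k) (continuous_basisField s k))
    ((integrableOn_closedInterior s ((continuous_basisField s k).norm.pow 2)).const_mul _)
    s.isClosed_closedInterior.measurableSet fun x hx =>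
      hm _ (basisField_mem_direction s hA k (mem_plane_of_mem_closedInterior s hA hx))

variable {c : E n} {ρ σ : ℝ}

theorem lumpedWeight_pos (hd : 0 < d) {m : ℝ} (hm0 : 0 < m)
    (hm : ∀ x ∈ A.direction, m * ‖x‖ ^ 2 ≤ inner ℝ (L x) x) (k : Fin (d + 1)) :
    0 < lumpedWeight s L k := by
  obtain ⟨c, hc, ρ, hρ, hball⟩ := exists_ball_subset_closedInterior s
  rw [hA] at hc hball
  -- Positivity needs no uniform constant, so `σ` is taken to be the diameter divided by `ρ`.
  have h1 := rtFlux_sq_le s hA hd hc hρ hball (div_mul_cancel₀ _ hρ.ne').ge (basisCoeff s hA k) k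
  have h2 := le_massForm s hA hm (basisCoeff s hA k)
  have h3 : massForm s L (basisCoeff s hA k) (basisCoeff s hA k) = lumpedWeight s L k := by
    simp only [massForm, lumpedWeight, rtField_basisCoeff]
  have hB := volume_real_closedBall_pos (D := A.direction) hρ
  rw [rtFlux_basisCoeff s hA hd, if_pos rfl, one_pow, one_mul] at h1
  rw [h3] at h2
  have h4 := pos_of_mul_pos_right (hB.trans_le h1) (by positivity)
  exact (mul_pos hm0 h4).trans_le h2

/-- The lumped form is bounded by the mass form. -/
theorem lumped_le_massForm (hd : 0 < d) {m κ : ℝ} (hm0 : 0 ≤ m)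
    (hm : ∀ x ∈ A.direction, m * ‖x‖ ^ 2 ≤ inner ℝ (L x) x)
    (hm' : ∀ x ∈ A.direction, inner ℝ (L x) x ≤ κ ^ 2 * m * ‖x‖ ^ 2)
    (hc : c ∈ A) (hρ : 0 < ρ) (hσ : 0 ≤ σ)
    (hball : Metric.closedBall c ρ ∩ A ⊆ s.closedInterior)
    (hdiam : Metric.diam s.closedInterior ≤ σ * ρ) (v : A.direction × ℝ) :
    ∑ k, rtFlux s v k * rtFlux s v k * lumpedWeight s L k ≤
      (d + 1) * (κ ^ 2 * σ ^ (d + 2) * (2 + 16 * σ ^ 2)) * massForm s L v v := by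
  -- The ball volume `V` links the bounds for the flux and the basis function, and `m` is absorbed
  -- by the mass form, so only `κ` and `σ` remain.
  have h : ∀ k, rtFlux s v k * rtFlux s v k * lumpedWeight s L k ≤
      κ ^ 2 * σ ^ (d + 2) * (2 + 16 * σ ^ 2) * massForm s L v v := by
    intro k
    have h1 := rtFlux_sq_le s hA hd hc hρ hball hdiam v k
    have h2 := integral_basisField_le s hA hd hc hρ hσ hball hdiam k
    have h3 := le_massForm s hA hm v
    have h4 := lumpedWeight_le s hA hm' k
    set V := volume.real (Metric.closedBall (0 : A.direction) ρ)
    set I := ∫ x in s.closedInterior, ‖rtField s v x‖ ^ 2 ∂μHE[d]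
    calc rtFlux s v k * rtFlux s v k * lumpedWeight s L k
        = rtFlux s v k ^ 2 * lumpedWeight s L k := by ring
      _ ≤ rtFlux s v k ^ 2 * (κ ^ 2 * m * (σ ^ (d + 2) * V)) := by
          gcongr
          exact h4.trans (by gcongr)
      _ = κ ^ 2 * m * σ ^ (d + 2) * (rtFlux s v k ^ 2 * V) := by ring
      _ ≤ κ ^ 2 * m * σ ^ (d + 2) * ((2 + 16 * σ ^ 2) * I) := by gcongr
      _ = κ ^ 2 * σ ^ (d + 2) * (2 + 16 * σ ^ 2) * (m * I) := by ring
      _ ≤ _ := by gcongr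
  refine (Finset.sum_le_sum fun k _ => h k).trans (le_of_eq ?_)
  rw [Finset.sum_const, Finset.card_univ, Fintype.card_fin, nsmul_eq_mul]
  push_cast
  ring

end LocalForm

/-! ### Spectral bounds for the permeability. -/

namespace MeshData

namespace Params

variable {n : ℕ} {M : MeshData n} (P : M.Params)

/-- The inverse permeability tensor as a linear map. -/
abbrev invK (i : M.Sub) : E n →ₗ[ℝ] E n := ((P.K i).symm : E n →ₗ[ℝ] E n)

theorem K_invK (i : M.Sub) (x : E n) : P.K i (P.invK i x) = x := (P.K i).apply_symm_apply x

theorem invK_symm (i : M.Sub) (x y : E n) : inner ℝ (P.invK i x) y = inner ℝ x (P.invK i y) := by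
  have h := P.K_symm i (P.invK i x) (P.invK i y)
  rw [K_invK, K_invK] at h
  exact h.symm

theorem inner_K_nonneg (i : M.Sub) (x : E n) : 0 ≤ inner ℝ (P.K i x) x := by
  by_cases hx : x = 0
  · simp [hx]
  · exact (P.K_pos i x hx).le

theorem inner_invK_eq (i : M.Sub) (x : E n) :
    inner ℝ (P.invK i x) x = inner ℝ (P.K i (P.invK i x)) (P.invK i x) := by
  rw [K_invK, real_inner_comm]

theorem inner_invK_nonneg (i : M.Sub) (x : E n) : 0 ≤ inner ℝ (P.invK i x) x := by
  rw [inner_invK_eq]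
  exact P.inner_K_nonneg i _

/-- `K` is injective and maps the tangential space into itself, hence onto itself by dimension. -/
theorem invK_mem (i : M.Sub) {x : E n} (hx : x ∈ (M.plane i).direction) :
    P.invK i x ∈ (M.plane i).direction := by
  have hmap : (M.plane i).direction.map (P.K i : E n →ₗ[ℝ] E n) = (M.plane i).direction := by
    refine Submodule.eq_of_le_of_finrank_eq ?_ (LinearEquiv.finrank_map_eq (P.K i) _)
    rintro _ ⟨y, hy, rfl⟩
    exact P.K_tangential i y hy
  rw [← hmap] at hx
  obtain ⟨y, hy, rfl⟩ := hx
  simpa using hy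

theorem inner_K_sq_le (i : M.Sub) (x y : E n) :
    inner ℝ (P.K i x) y ^ 2 ≤ inner ℝ (P.K i x) x * inner ℝ (P.K i y) y := by
  have h : ∀ t : ℝ, 0 ≤ inner ℝ (P.K i y) y * (t * t) + 2 * inner ℝ (P.K i x) y * t +
      inner ℝ (P.K i x) x := by
    intro t
    have h1 := P.inner_K_nonneg i (x + t • y)
    have h2 : inner ℝ (P.K i y) x = inner ℝ (P.K i x) y := by rw [P.K_symm, real_inner_comm]
    simp only [map_add, map_smul, inner_add_left, inner_add_right, inner_smul_left,
      inner_smul_right, conj_trivial, h2] at h1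
    linarith
  have h3 := discrim_le_zero h
  rw [discrim] at h3
  nlinarith

/-- Spectral bounds for the inverse permeability in terms of the anisotropy. -/
theorem exists_bounds_invK {κ : ℝ} (hκ : P.AnisotropyLE κ) (i : M.Sub)
    (hD : 0 < Module.finrank ℝ (M.plane i).direction) :
    ∃ m : ℝ, 0 < m ∧ (∀ x ∈ (M.plane i).direction, m * ‖x‖ ^ 2 ≤ inner ℝ (P.invK i x) x) ∧
      ∀ x ∈ (M.plane i).direction, inner ℝ (P.invK i x) x ≤ κ ^ 2 * m * ‖x‖ ^ 2 := by
  have : Nontrivial (M.plane i).direction := Module.finrank_pos_iff.1 hD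
  obtain ⟨e, he⟩ := exists_norm_eq (M.plane i).direction zero_le_one
  have he' : ‖(e : E n)‖ = 1 := he
  set μ := inner ℝ (P.K i e) (e : E n) with hμ
  have hμ0 : 0 < μ := P.K_pos i _ (by rw [← norm_pos_iff, he']; exact one_pos)
  have hκ0 : 0 < κ := by
    have h := hκ i e e.2 e e.2 he' he'
    by_contra hneg
    nlinarith [mul_nonneg (sub_nonneg.2 (not_lt.1 hneg)) hμ0.le]
  have hscale : ∀ x : E n, x ≠ 0 →
      inner ℝ (P.K i x) x = ‖x‖ ^ 2 * inner ℝ (P.K i (‖x‖⁻¹ • x)) (‖x‖⁻¹ • x) := by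
    intro x hx
    have hx' : ‖x‖ ≠ 0 := norm_ne_zero_iff.2 hx
    rw [map_smul, inner_smul_left, inner_smul_right]
    simp only [conj_trivial]
    field_simp
  have hunit : ∀ x : E n, x ≠ 0 → ‖‖x‖⁻¹ • x‖ = 1 := fun x hx => norm_smul_inv_norm hx
  have hup : ∀ x ∈ (M.plane i).direction, inner ℝ (P.K i x) x ≤ κ * μ * ‖x‖ ^ 2 := by
    intro x hx
    by_cases hx0 : x = 0
    · simp [hx0]
    rw [hscale x hx0, mul_comm]
    exact mul_le_mul_of_nonneg_right (hκ i _ (Submodule.smul_mem _ _ hx) e e.2 (hunit x hx0) he')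
      (sq_nonneg _)
  have hlow : ∀ x ∈ (M.plane i).direction, μ * ‖x‖ ^ 2 ≤ κ * inner ℝ (P.K i x) x := by
    intro x hx
    by_cases hx0 : x = 0
    · simp [hx0]
    rw [hscale x hx0, mul_comm, mul_left_comm]
    exact mul_le_mul_of_nonneg_left (hκ i e e.2 _ (Submodule.smul_mem _ _ hx) he' (hunit x hx0))
      (sq_nonneg _)
  -- On tangential unit vectors the quadratic form of `K` lies between `μ/κ` and `κμ`. The reference
  -- vector `e` is arbitrary rather than an eigenvector, which costs `κ²` in place of `κ`.
  refine ⟨(κ * μ)⁻¹, by positivity, fun x hx => ?_, fun x hx => ?_⟩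
  · by_cases hx0 : x = 0
    · simp [hx0]
    have hx' : 0 < ‖x‖ ^ 2 := by have := norm_pos_iff.2 hx0; positivity
    rw [inv_mul_le_iff₀ (by positivity)]
    -- Cauchy–Schwarz for the form of `K` at `K⁻¹x` and `x` gives `‖x‖⁴ ≤ ⟨K⁻¹x, x⟩⟨Kx, x⟩`.
    have h1 := P.inner_K_sq_le i (P.invK i x) x
    rw [← inner_invK_eq, K_invK, real_inner_self_eq_norm_sq] at h1
    have h2 := mul_le_mul_of_nonneg_left (hup x hx) (P.inner_invK_nonneg i x)
    refine le_of_mul_le_mul_right ?_ hx'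
    nlinarith
  · have hz := P.invK_mem i hx
    have h1 := hlow _ hz
    rw [← inner_invK_eq] at h1
    have h2 := real_inner_le_norm (P.invK i x) x
    have h3 : μ * ‖P.invK i x‖ ≤ κ * ‖x‖ := by
      by_cases h0 : ‖P.invK i x‖ = 0
      · rw [h0, mul_zero]; positivity
      have h0' : 0 < ‖P.invK i x‖ := lt_of_le_of_ne (norm_nonneg _) (Ne.symm h0)
      refine le_of_mul_le_mul_right ?_ h0'
      nlinarith
    have h4 : κ ^ 2 * (κ * μ)⁻¹ * ‖x‖ ^ 2 = μ⁻¹ * (κ * ‖x‖) * ‖x‖ := by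
      field_simp
    rw [h4]
    refine h2.trans (mul_le_mul_of_nonneg_right ?_ (norm_nonneg _))
    rw [le_inv_mul_iff₀ hμ0]
    exact h3

/-- By compactness of the unit sphere. It serves the definiteness statements, in which no bound `κ`
is given. -/
theorem exists_anisotropyLE : ∃ κ : ℝ, P.AnisotropyLE κ := by
  have hi : ∀ i, ∃ κ : ℝ, 0 ≤ κ ∧ ∀ x y : E n, ‖x‖ = 1 → ‖y‖ = 1 →
      inner ℝ (P.K i x) x ≤ κ * inner ℝ (P.K i y) y := by
    intro i
    have hcont : Continuous fun x : E n => inner ℝ (P.K i x) x :=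
      ((P.K i : E n →ₗ[ℝ] E n).continuous_of_finiteDimensional).inner continuous_id
    rcases (Metric.sphere (0 : E n) 1).eq_empty_or_nonempty with h | h
    · refine ⟨0, le_rfl, fun x y hx _ => ?_⟩
      have : x ∈ Metric.sphere (0 : E n) 1 := by simpa using hx
      simp [h] at this
    obtain ⟨x₀, hx₀, hmax⟩ := (isCompact_sphere (0 : E n) 1).exists_isMaxOn h hcont.continuousOn
    obtain ⟨y₀, hy₀, hmin⟩ := (isCompact_sphere (0 : E n) 1).exists_isMinOn h hcont.continuousOn
    have hy : 0 < inner ℝ (P.K i y₀) y₀ := P.K_pos i y₀ (by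
      rintro rfl
      simp at hy₀)
    refine ⟨inner ℝ (P.K i x₀) x₀ / inner ℝ (P.K i y₀) y₀,
      div_nonneg (P.inner_K_nonneg i _) hy.le, fun x y hx hy' => ?_⟩
    have h1 : inner ℝ (P.K i x) x ≤ inner ℝ (P.K i x₀) x₀ := hmax (by simpa using hx)
    have h2 : inner ℝ (P.K i y₀) y₀ ≤ inner ℝ (P.K i y) y := hmin (by simpa using hy')
    rw [div_mul_eq_mul_div, le_div_iff₀ hy]
    exact mul_le_mul h1 h2 hy.le (P.inner_K_nonneg i _)
  choose κ hκ0 hκ using hi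
  refine ⟨∑ i, κ i, fun i x _ y _ hx hy => (hκ i x y hx hy).trans ?_⟩
  exact mul_le_mul_of_nonneg_right (Finset.single_le_sum (fun j _ => hκ0 j) (Finset.mem_univ i))
    (P.inner_K_nonneg i y)

end Params

end MeshData

/-! ### The global forms: symmetry, equivalence and definiteness. -/

namespace MeshData

variable {n : ℕ} {M : MeshData n}

theorem flux_add (v w : M.Field) (i : M.Sub) (T : M.Cell i) (k : Fin (M.dim i + 1)) :
    M.flux (v + w) i T k = M.flux v i T k + M.flux w i T k := rtFlux_add _ _ _ _

theorem flux_smul (c : ℝ) (v : M.Field) (i : M.Sub) (T : M.Cell i) (k : Fin (M.dim i + 1)) :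
    M.flux (c • v) i T k = c * M.flux v i T k := rtFlux_smul _ _ _ _

namespace Params

variable (P : M.Params) (R : M.Lh →ₗ[ℝ] M.Vh)

theorem total_add (w r : M.Wh) : total R (w + r) = total R w + total R r := by
  simp only [total, Prod.fst_add, Prod.snd_add, map_add, Submodule.coe_add]
  abel

theorem total_smul (c : ℝ) (w : M.Wh) : total R (c • w) = c • total R w := by
  simp only [total, Prod.smul_fst, Prod.smul_snd, map_smul, Submodule.coe_smul, smul_add]

theorem total_eq_zero_of_dim (w : M.Wh) (i : M.Sub) (hi : M.dim i = 0) : total R w i = 0 := by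
  rw [total, Pi.add_apply, w.1.2.1.1 i hi, (R w.2).2.1 i hi, add_zero]

/-- The integral of `γ Kν⁻¹` over a mortar element. -/
def mortarWeight (g : M.Iface) (m : M.MCell g) : ℝ :=
  ∫ x in (M.mcell g m).closedInterior, P.γ g * (P.Kν g x)⁻¹ ∂μHE[M.dim (M.lower g)]

theorem mortarForm_eq (lam μ : M.Lh) :
    P.mortarForm lam μ = ∑ g, ∑ m, P.mortarWeight g m * lam g m * μ g m := by
  simp only [mortarForm, mortarWeight, integral_mul_const]

variable {P} in
-- The upper bound of `Kν` bounds the integrand below on a set of positive measure; the lower bound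
-- makes it integrable.
theorem mortarWeight_pos (hM : M.IsMesh) (g : M.Iface) (m : M.MCell g) :
    0 < P.mortarWeight g m := by
  obtain ⟨c, C, hc, hcC⟩ := P.Kν_bounds g
  have hsub : ∀ x ∈ (M.mcell g m).closedInterior, x ∈ M.region (M.lower g) := fun x hx =>
    hM.mortar_cover g ▸ Set.mem_iUnion.2 ⟨m, hx⟩
  have hγ := P.γ_pos g
  have hmeas := (M.mcell g m).isClosed_closedInterior.measurableSet
  have hfin := (measure_closedInterior_lt_top (M.mcell g m)).ne
  obtain ⟨x₀, hx₀⟩ := (M.mcell g m).nonempty_closedInterior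
  have hC : 0 < C := hc.trans_le ((hcC x₀ (hsub x₀ hx₀)).1.trans (hcC x₀ (hsub x₀ hx₀)).2)
  have hint : IntegrableOn (fun x => P.γ g * (P.Kν g x)⁻¹) (M.mcell g m).closedInterior
      μHE[M.dim (M.lower g)] := by
    refine Measure.integrableOn_of_bounded (M := P.γ g * c⁻¹) hfin
      ((P.Kν_measurable g).inv.const_mul _).aestronglyMeasurable
      (ae_restrict_of_forall_mem hmeas fun x hx => ?_)
    have h := hcC x (hsub x hx)
    have h0 : 0 < P.Kν g x := hc.trans_le h.1
    rw [Real.norm_of_nonneg (by positivity)]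
    gcongr
    exact h.1
  have h := setIntegral_mono_on (f := fun _ => P.γ g * C⁻¹) (integrableOn_const hfin) hint hmeas
    fun x hx => by
      have h := hcC x (hsub x hx)
      have h0 : 0 < P.Kν g x := hc.trans_le h.1
      gcongr
      exact h.2
  rw [setIntegral_const, smul_eq_mul] at h
  exact (mul_pos (measureReal_closedInterior_pos _) (by positivity)).trans_le h

theorem a_eq (w r : M.Wh) : P.a R w r = (∑ i, ∑ T, massForm (M.cell i T) (P.invK i)
    (total R w i T) (total R r i T)) + P.mortarForm w.2 r.2 := rfl

theorem aD_eq (w r : M.Wh) : P.aD R w r = (∑ i, ∑ T, ∑ k, M.flux (total R w) i T k *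
    M.flux (total R r) i T k * lumpedWeight (M.cell i T) (P.invK i) k) +
      P.mortarForm w.2 r.2 := rfl

theorem mortarForm_comm (lam μ : M.Lh) : P.mortarForm lam μ = P.mortarForm μ lam := by
  simp only [mortarForm_eq, mul_assoc, mul_comm (lam _ _)]

theorem mortarForm_add_left (lam lam' μ : M.Lh) :
    P.mortarForm (lam + lam') μ = P.mortarForm lam μ + P.mortarForm lam' μ := by
  simp only [mortarForm_eq, Pi.add_apply, mul_add, add_mul, Finset.sum_add_distrib]

theorem mortarForm_smul_left (c : ℝ) (lam μ : M.Lh) :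
    P.mortarForm (c • lam) μ = c * P.mortarForm lam μ := by
  simp only [mortarForm_eq, Pi.smul_apply, smul_eq_mul, Finset.mul_sum]
  exact Finset.sum_congr rfl fun g _ => Finset.sum_congr rfl fun m _ => by ring

theorem mortarForm_self_nonneg (hM : M.IsMesh) (lam : M.Lh) : 0 ≤ P.mortarForm lam lam := by
  rw [mortarForm_eq]
  refine Finset.sum_nonneg fun g _ => Finset.sum_nonneg fun m _ => ?_
  rw [mul_assoc]
  exact mul_nonneg (mortarWeight_pos hM g m).le (mul_self_nonneg _)

theorem eq_zero_of_mortarForm_self (hM : M.IsMesh) {lam : M.Lh} (h : P.mortarForm lam lam ≤ 0) :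
    lam = 0 := by
  have hnn : ∀ g m, 0 ≤ P.mortarWeight g m * lam g m * lam g m := fun g m => by
    rw [mul_assoc]
    exact mul_nonneg (mortarWeight_pos hM g m).le (mul_self_nonneg _)
  have h0 := le_antisymm h (P.mortarForm_self_nonneg hM lam)
  rw [mortarForm_eq,
    Finset.sum_eq_zero_iff_of_nonneg fun g _ => Finset.sum_nonneg fun m _ => hnn g m] at h0
  funext g m
  have h1 := (Finset.sum_eq_zero_iff_of_nonneg fun m _ => hnn g m).1 (h0 g (Finset.mem_univ g)) m
    (Finset.mem_univ m)
  rw [mul_assoc, mul_eq_zero, mul_self_eq_zero] at h1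
  exact h1.resolve_left (mortarWeight_pos hM g m).ne'

theorem a_comm (w r : M.Wh) : P.a R w r = P.a R r w := by
  rw [a_eq, a_eq, mortarForm_comm]
  simp only [massForm_comm _ (P.invK_symm _) (total R w _ _)]

theorem aD_comm (w r : M.Wh) : P.aD R w r = P.aD R r w := by
  rw [aD_eq, aD_eq, mortarForm_comm]
  simp only [mul_comm (M.flux (total R w) _ _ _)]

/-- The form `a` as a bilinear form. -/
def aForm : LinearMap.BilinForm ℝ M.Wh :=
  have hadd : ∀ w w' r, P.a R (w + w') r = P.a R w r + P.a R w' r := fun w w' r => by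
    simp only [a_eq, total_add, Pi.add_apply, massForm_add_left, Finset.sum_add_distrib,
      Prod.snd_add, mortarForm_add_left]
    ring
  have hsmul : ∀ (c : ℝ) w r, P.a R (c • w) r = c * P.a R w r := fun c w r => by
    simp only [a_eq, total_smul, Pi.smul_apply, massForm_smul_left, Prod.smul_snd,
      mortarForm_smul_left, mul_add, Finset.mul_sum]
  LinearMap.mk₂ ℝ (P.a R) hadd hsmul
    (fun w r r' => by rw [a_comm, hadd, a_comm P R r, a_comm P R r'])
    (fun c w r => by rw [a_comm, hsmul, a_comm P R r, smul_eq_mul])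

/-- The form `a^D` as a bilinear form. -/
def aDForm : LinearMap.BilinForm ℝ M.Wh :=
  have hadd : ∀ w w' r, P.aD R (w + w') r = P.aD R w r + P.aD R w' r := fun w w' r => by
    simp only [aD_eq, total_add, flux_add, add_mul, Finset.sum_add_distrib,
      Prod.snd_add, mortarForm_add_left]
    ring
  have hsmul : ∀ (c : ℝ) w r, P.aD R (c • w) r = c * P.aD R w r := fun c w r => by
    simp only [aD_eq, total_smul, flux_smul, Prod.smul_snd,
      mortarForm_smul_left, mul_add, Finset.mul_sum, mul_assoc]
  LinearMap.mk₂ ℝ (P.aD R) hadd hsmul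
    (fun w r r' => by rw [aD_comm, hadd, aD_comm P R r, aD_comm P R r'])
    (fun c w r => by rw [aD_comm, hsmul, aD_comm P R r, smul_eq_mul])

theorem aDForm_apply (w r : M.Wh) : P.aDForm R w r = P.aD R w r := rfl

variable {P R}

theorem lumped_nonneg (r : M.Wh) (i : M.Sub) (T : M.Cell i) (k : Fin (M.dim i + 1)) :
    0 ≤ M.flux (total R r) i T k * M.flux (total R r) i T k *
      lumpedWeight (M.cell i T) (P.invK i) k :=
  mul_nonneg (mul_self_nonneg _) (lumpedWeight_nonneg _ (P.inner_invK_nonneg i) k)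

theorem a_self_nonneg (hM : M.IsMesh) (r : M.Wh) : 0 ≤ P.a R r r :=
  add_nonneg (Finset.sum_nonneg fun i _ => Finset.sum_nonneg fun _ _ =>
    massForm_self_nonneg _ (P.inner_invK_nonneg i) _) (P.mortarForm_self_nonneg hM _)

theorem aD_self_nonneg (hM : M.IsMesh) (r : M.Wh) : 0 ≤ P.aD R r r :=
  add_nonneg (Finset.sum_nonneg fun _ _ => Finset.sum_nonneg fun _ _ =>
    Finset.sum_nonneg fun _ _ => lumped_nonneg r _ _ _) (P.mortarForm_self_nonneg hM _)

theorem massForm_le_lumped (hM : M.IsMesh) (r : M.Wh) (i : M.Sub) (T : M.Cell i) :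
    massForm (M.cell i T) (P.invK i) (total R r i T) (total R r i T) ≤
      (n + 1) * ∑ k, M.flux (total R r) i T k * M.flux (total R r) i T k *
        lumpedWeight (M.cell i T) (P.invK i) k := by
  have hnn : 0 ≤ ∑ k, M.flux (total R r) i T k * M.flux (total R r) i T k *
        lumpedWeight (M.cell i T) (P.invK i) k := Finset.sum_nonneg fun k _ => lumped_nonneg r i T k
  rcases Nat.eq_zero_or_pos (M.dim i) with hd | hd
  · have h0 : massForm (M.cell i T) (P.invK i) (total R r i T) (total R r i T) = 0 := by
      rw [total_eq_zero_of_dim R r i hd]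
      simp [massForm, rtField]
    rw [h0]
    positivity
  · have hA := hM.affineSpan_cell i T
    refine (massForm_self_le (M.cell i T) hA hd (P.invK_symm i) (P.inner_invK_nonneg i) _).trans ?_
    have hdn : (M.dim i : ℝ) ≤ n := by exact_mod_cast dim_le (M.cell i T) hA
    exact mul_le_mul_of_nonneg_right (by linarith) hnn

/-- The form `a` is bounded by `a^D`. -/
theorem a_self_le (hM : M.IsMesh) (r : M.Wh) : P.a R r r ≤ (n + 1) * P.aD R r r := by
  rw [a_eq, aD_eq, mul_add, Finset.mul_sum]
  simp_rw [Finset.mul_sum Finset.univ (fun T => ∑ k, _)]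
  refine add_le_add (Finset.sum_le_sum fun i _ => Finset.sum_le_sum fun T _ =>
    massForm_le_lumped hM r i T) ?_
  nlinarith [P.mortarForm_self_nonneg hM r.2, (Nat.cast_nonneg n : (0 : ℝ) ≤ n)]

/-- A bound for `a^D` by `a` that depends only on `n`, the shape regularity and the anisotropy. -/
def lumpingBound (n : ℕ) (σ κ : ℝ) : ℝ :=
  (n + 1) * (κ ^ 2 * max 1 σ ^ (n + 2) * (2 + 16 * σ ^ 2)) + 1

theorem lumpingBound_pos (n : ℕ) (σ κ : ℝ) : 0 < lumpingBound n σ κ := by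
  have : 0 ≤ max 1 σ := zero_le_one.trans (le_max_left _ _)
  unfold lumpingBound
  positivity

theorem lumped_le_mass {σ κ : ℝ} (hM : M.IsMesh) (hσ : M.ShapeRegular σ) (hκ : P.AnisotropyLE κ)
    (r : M.Wh) (i : M.Sub) (T : M.Cell i) :
    ∑ k, M.flux (total R r) i T k * M.flux (total R r) i T k *
        lumpedWeight (M.cell i T) (P.invK i) k ≤
      lumpingBound n σ κ *
        massForm (M.cell i T) (P.invK i) (total R r i T) (total R r i T) := by
  have hnn := massForm_self_nonneg (M.cell i T) (P.inner_invK_nonneg i) (total R r i T)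
  rcases Nat.eq_zero_or_pos (M.dim i) with hd | hd
  · have h0 : ∀ k, M.flux (total R r) i T k = 0 := fun k => by
      rw [flux, total_eq_zero_of_dim R r i hd]
      exact rtFlux_zero _ _
    simp only [h0, zero_mul, Finset.sum_const_zero]
    exact mul_nonneg (lumpingBound_pos n σ κ).le hnn
  · have hA := hM.affineSpan_cell i T
    obtain ⟨c, hc, ρ, hρ, hball, hdiam⟩ := hσ i T hd
    have hσ0 : 0 ≤ σ := nonneg_of_mul_nonneg_left (Metric.diam_nonneg.trans hdiam) hρ
    obtain ⟨m, hm0, hm, hm'⟩ := P.exists_bounds_invK hκ i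
      (by rwa [finrank_direction (M.cell i T) hA])
    refine (lumped_le_massForm (M.cell i T) hA hd hm0.le hm hm' hc hρ hσ0 hball hdiam _).trans ?_
    refine mul_le_mul_of_nonneg_right ?_ hnn
    have hdn : M.dim i ≤ n := dim_le (M.cell i T) hA
    -- The maximum with `1` makes the power monotone in the exponent, so one bound serves all
    -- dimensions up to `n`.
    have hpow : σ ^ (M.dim i + 2) ≤ max 1 σ ^ (n + 2) :=
      (pow_le_pow_left₀ hσ0 (le_max_right _ _) _).trans
        (pow_le_pow_right₀ (le_max_left _ _) (by lia))
    have hdn' : (M.dim i : ℝ) ≤ n := by exact_mod_cast hdn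
    calc _ ≤ (n + 1 : ℝ) * (κ ^ 2 * max 1 σ ^ (n + 2) * (2 + 16 * σ ^ 2)) := by gcongr
      _ ≤ _ := by rw [lumpingBound]; linarith

/-- The form `a^D` is bounded by `a`. -/
theorem aD_self_le {σ κ : ℝ} (hM : M.IsMesh) (hσ : M.ShapeRegular σ) (hκ : P.AnisotropyLE κ)
    (r : M.Wh) : P.aD R r r ≤ lumpingBound n σ κ * P.a R r r := by
  rw [a_eq, aD_eq, mul_add, Finset.mul_sum]
  simp_rw [Finset.mul_sum Finset.univ (fun T => massForm _ _ _ _)]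
  refine add_le_add (Finset.sum_le_sum fun i _ => Finset.sum_le_sum fun T _ =>
    lumped_le_mass hM hσ hκ r i T) ?_
  -- The mortar term is the same in both forms; the summand `1` of the bound covers it.
  have h1 : 1 ≤ lumpingBound n σ κ := by
    have : 0 ≤ max 1 σ := zero_le_one.trans (le_max_left _ _)
    rw [lumpingBound, le_add_iff_nonneg_left]
    positivity
  nlinarith [P.mortarForm_self_nonneg hM r.2]

theorem field_ext (hM : M.IsMesh) {v w : M.Field} (hv : ∀ i, M.dim i = 0 → v i = w i)
    (h : ∀ i T k, 0 < M.dim i → M.flux v i T k = M.flux w i T k) : v = w := by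
  funext i
  rcases Nat.eq_zero_or_pos (M.dim i) with hd | hd
  · exact hv i hd
  · funext T
    exact rtFlux_injective (M.cell i T) (hM.affineSpan_cell i T) hd (funext fun k => h i T k hd)

/-- The form `a^D` is definite. -/
theorem eq_zero_of_aD_self (hM : M.IsMesh) {r : M.Wh} (h : P.aD R r r = 0) : r = 0 := by
  have hL := lumped_nonneg (P := P) (R := R) r
  have hS : 0 ≤ ∑ i, ∑ T, ∑ k, M.flux (total R r) i T k * M.flux (total R r) i T k *
      lumpedWeight (M.cell i T) (P.invK i) k :=
    Finset.sum_nonneg fun _ _ => Finset.sum_nonneg fun _ _ => Finset.sum_nonneg fun _ _ => hL _ _ _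
  have hm := P.mortarForm_self_nonneg hM r.2
  rw [aD_eq] at h
  have h2 : r.2 = 0 := P.eq_zero_of_mortarForm_self hM (by linarith)
  have h1 := le_antisymm (by linarith : _ ≤ (0 : ℝ)) hS
  rw [Finset.sum_eq_zero_iff_of_nonneg fun i _ => Finset.sum_nonneg fun T _ =>
    Finset.sum_nonneg fun k _ => hL i T k] at h1
  have hflux : ∀ i T k, 0 < M.dim i → M.flux (total R r) i T k = 0 := by
    intro i T k hd
    have h3 := (Finset.sum_eq_zero_iff_of_nonneg fun T _ =>
      Finset.sum_nonneg fun k _ => hL i T k).1 (h1 i (Finset.mem_univ i)) T (Finset.mem_univ T)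
    have h4 := (Finset.sum_eq_zero_iff_of_nonneg fun k _ => hL i T k).1 h3 k (Finset.mem_univ k)
    obtain ⟨κ, hκ⟩ := P.exists_anisotropyLE
    have hA := hM.affineSpan_cell i T
    obtain ⟨m, hm0, hm, -⟩ := P.exists_bounds_invK hκ i
      (by rwa [finrank_direction (M.cell i T) hA])
    have hw := lumpedWeight_pos (M.cell i T) hA hd hm0 hm k
    rw [mul_eq_zero, mul_self_eq_zero] at h4
    exact h4.resolve_right hw.ne'
  have htot : total R r = 0 := field_ext hM (fun i hi => total_eq_zero_of_dim R r i hi)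
    fun i T k hd => (hflux i T k hd).trans (rtFlux_zero _ _).symm
  rw [total, h2, map_zero, Submodule.coe_zero, add_zero] at htot
  exact Prod.ext (Subtype.ext htot) h2

end Params

end MeshData

/-! ### Fields with prescribed fluxes, and the form `b` as a sum over facets. -/

namespace MeshData

variable {n : ℕ} {M : MeshData n}

/-- The facets of all the elements, each seen from its element. -/
abbrev Facet (M : MeshData n) := Σ i : M.Sub, M.Cell i × Fin (M.dim i + 1)

/-- The facet `f` is shared with a neighbouring element, of which it is the facet `f'`. -/
def FacetPair (f f' : M.Facet) : Prop :=
  ∃ i T k T' k', f = ⟨i, T, k⟩ ∧ f' = ⟨i, T', k'⟩ ∧ M.InteriorPair i T k T' k'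

theorem onGamma_congr {i : M.Sub} {T T' : M.Cell i} {k k' : Fin (M.dim i + 1)}
    (h : (M.cell i T).points '' {k}ᶜ = (M.cell i T').points '' {k'}ᶜ) :
    M.OnGamma i T k ↔ M.OnGamma i T' k' := by
  simp only [OnGamma, facet, h]

theorem InteriorPair.symm {i : M.Sub} {T T' : M.Cell i} {k k' : Fin (M.dim i + 1)}
    (h : M.InteriorPair i T k T' k') : M.InteriorPair i T' k' T k :=
  ⟨h.1, h.2.1.symm, h.2.2.1.symm, fun h' => h.2.2.2 ((onGamma_congr h.2.2.1).2 h')⟩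

theorem FacetPair.symm {f f' : M.Facet} (h : FacetPair f f') : FacetPair f' f := by
  obtain ⟨i, T, k, T', k', rfl, rfl, h⟩ := h
  exact ⟨i, T', k', T, k, rfl, rfl, h.symm⟩

/-- The mesh axioms fix the neighbouring element; the index of the facet is then fixed because the
vertices are distinct. -/
theorem FacetPair.unique (hM : M.IsMesh) {f g g' : M.Facet} (h : FacetPair f g)
    (h' : FacetPair f g') : g = g' := by
  obtain ⟨i, T, k, T₁, k₁, rfl, rfl, h⟩ := h
  obtain ⟨i', T', k', T₂, k₂, hf, rfl, h'⟩ := h'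
  obtain rfl : i = i' := congrArg Sigma.fst hf
  obtain ⟨rfl, rfl⟩ := Prod.mk.inj (eq_of_heq (Sigma.mk.inj hf).2)
  obtain rfl := hM.neighbour_unique i T T₁ T₂ k k₁ k₂ h h'
  have himg := h.2.2.1.symm.trans h'.2.2.1
  have hk := (Set.image_injective.2 (M.cell i T₁).independent.injective) himg
  rw [compl_inj_iff, Set.singleton_eq_singleton_iff] at hk
  rw [hk]

theorem OnGamma.dim_pos {i : M.Sub} {T : M.Cell i} {k : Fin (M.dim i + 1)}
    (h : M.OnGamma i T k) : 0 < M.dim i := by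
  obtain ⟨j, hj, -⟩ := h
  lia

theorem InIface.onGamma (hM : M.IsMesh) {g : M.Iface} {T : M.Cell (M.upper g)}
    {k : Fin (M.dim (M.upper g) + 1)} (h : M.InIface g T k) : M.OnGamma (M.upper g) T k :=
  ⟨M.lower g, (hM.dim_upper g).symm, h.1⟩

open Classical in
/-- The field with prescribed normal components on all the facets. -/
def fieldOfFlux (hM : M.IsMesh) (c : M.Facet → ℝ) : M.Field := fun i T =>
  if M.dim i = 0 then 0 else ofFlux (M.cell i T) (hM.affineSpan_cell i T) fun k => c ⟨i, T, k⟩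

theorem fieldOfFlux_of_dim (hM : M.IsMesh) (c : M.Facet → ℝ) {i : M.Sub} (hi : M.dim i = 0) :
    fieldOfFlux hM c i = 0 := by
  funext T
  rw [fieldOfFlux, if_pos hi]
  rfl

theorem flux_fieldOfFlux (hM : M.IsMesh) (c : M.Facet → ℝ) {i : M.Sub} (hi : 0 < M.dim i)
    (T : M.Cell i) (k : Fin (M.dim i + 1)) : M.flux (fieldOfFlux hM c) i T k = c ⟨i, T, k⟩ := by
  rw [flux, fieldOfFlux, if_neg hi.ne', rtFlux_ofFlux _ _ hi]

theorem fieldOfFlux_mem_Vh (hM : M.IsMesh) {c : M.Facet → ℝ}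
    (hpair : ∀ f f', FacetPair f f' → c f + c f' = 0)
    (hout : ∀ i T k, M.Outer i T k → ¬ M.DirichletFacet i T k → c ⟨i, T, k⟩ = 0) :
    fieldOfFlux hM c ∈ M.Vh := by
  refine ⟨fun i hi => fieldOfFlux_of_dim hM c hi, fun i T k T' k' h => ?_, fun i T k h h' => ?_⟩
  · rw [flux_fieldOfFlux hM c h.1, flux_fieldOfFlux hM c h.1]
    exact hpair _ _ ⟨i, T, k, T', k', rfl, rfl, h⟩
  · rw [flux_fieldOfFlux hM c h.1]
    exact hout i T k h h'

theorem fieldOfFlux_mem_V0h (hM : M.IsMesh) {c : M.Facet → ℝ}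
    (hpair : ∀ f f', FacetPair f f' → c f + c f' = 0)
    (hout : ∀ i T k, M.Outer i T k → ¬ M.DirichletFacet i T k → c ⟨i, T, k⟩ = 0)
    (hΓ : ∀ i T k, M.OnGamma i T k → c ⟨i, T, k⟩ = 0) : fieldOfFlux hM c ∈ M.V0h :=
  ⟨fieldOfFlux_mem_Vh hM hpair hout, fun i T k h => by
    rw [flux_fieldOfFlux hM c h.dim_pos, hΓ i T k h]⟩

/-- Facets on interfaces are neither paired nor outer, so `V_h` leaves their fluxes free. Hence the
projection property of the extension can be tested with arbitrary traces. -/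
theorem fieldOfFlux_mem_Vh_of_onGamma (hM : M.IsMesh) {c : M.Facet → ℝ}
    (hc : ∀ i T k, ¬ M.OnGamma i T k → c ⟨i, T, k⟩ = 0) : fieldOfFlux hM c ∈ M.Vh := by
  refine fieldOfFlux_mem_Vh hM ?_ fun i T k h _ => hc i T k h.2.1
  rintro _ _ ⟨i, T, k, T', k', rfl, rfl, h⟩
  rw [hc i T k h.2.2.2, hc i T' k' h.symm.2.2.2, add_zero]

/-- The number `d |T| / h`, with `h` the height of the element `T` over its facet `f`. -/
def facetWeight (f : M.Facet) : ℝ :=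
  M.dim f.1 / height (M.cell f.1 f.2.1) f.2.2 *
    (μHE[M.dim f.1]).real (M.cell f.1 f.2.1).closedInterior

theorem facetWeight_pos {i : M.Sub} (hi : 0 < M.dim i) (T : M.Cell i) (k : Fin (M.dim i + 1)) :
    0 < facetWeight (⟨i, T, k⟩ : M.Facet) := by
  have h1 := height_pos (M.cell i T) hi k
  have h2 := measureReal_closedInterior_pos (M.cell i T)
  have h3 : (0 : ℝ) < M.dim i := by exact_mod_cast hi
  simp only [facetWeight]
  positivity

/-- The divergence theorem on one element. Geometrically the weight is the measure of the facet, but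
below only its positivity matters, so the volume formula for a simplex is not needed. -/
theorem rtDiv_mul_measure (hM : M.IsMesh) (v : M.Field) (i : M.Sub) (T : M.Cell i) :
    rtDiv (M.dim i) (v i T) * (μHE[M.dim i]).real (M.cell i T).closedInterior =
      ∑ k, M.flux v i T k * facetWeight (⟨i, T, k⟩ : M.Facet) := by
  rcases Nat.eq_zero_or_pos (M.dim i) with hd | hd
  · simp [rtDiv, facetWeight, hd]
  · rw [rtDiv_eq_sum (M.cell i T) (hM.affineSpan_cell i T) hd, Finset.sum_mul]
    exact Finset.sum_congr rfl fun k _ => by rw [facetWeight, flux, mul_assoc]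

theorem b_eq (hM : M.IsMesh) (R : M.Lh →ₗ[ℝ] M.Vh) (r : M.Wh) (q : M.Qh) :
    b R r q = -((∑ f : M.Facet, M.flux (Params.total R r) f.1 f.2.1 f.2.2 *
      (q f.1 f.2.1 * facetWeight f)) + jumpPairing q r.2) := by
  rw [b, Fintype.sum_sigma]
  congr 2
  refine Finset.sum_congr rfl fun i _ => ?_
  rw [Fintype.sum_prod_type]
  refine Finset.sum_congr rfl fun T _ => ?_
  rw [mul_assoc, rtDiv_mul_measure hM, Finset.mul_sum]
  exact Finset.sum_congr rfl fun k _ => by ring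

/-! ### Pressures orthogonal to all divergences, inside one subdomain. -/

section Kernel

variable (hM : M.IsMesh) {R : M.Lh →ₗ[ℝ] M.Vh} {q : M.Qh} (hq : ∀ r, b R r q = 0)

include hM hq

theorem sum_flux_eq_zero {c : M.Facet → ℝ}
    (hpair : ∀ f f', FacetPair f f' → c f + c f' = 0)
    (hout : ∀ i T k, M.Outer i T k → ¬ M.DirichletFacet i T k → c ⟨i, T, k⟩ = 0)
    (hΓ : ∀ i T k, M.OnGamma i T k → c ⟨i, T, k⟩ = 0) :
    ∑ f : M.Facet, c f * (q f.1 f.2.1 * facetWeight f) = 0 := by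
  have h := hq (⟨fieldOfFlux hM c, fieldOfFlux_mem_V0h hM hpair hout hΓ⟩, 0)
  rw [b_eq hM, neg_eq_zero] at h
  have h1 : jumpPairing q (0 : M.Lh) = 0 := by simp [jumpPairing]
  rw [h1, add_zero] at h
  rw [← h]
  refine Finset.sum_congr rfl ?_
  rintro ⟨i, T, k⟩ -
  simp only [Params.total, map_zero, Submodule.coe_zero, add_zero]
  rcases Nat.eq_zero_or_pos (M.dim i) with hd | hd
  · simp [facetWeight, hd]
  · rw [flux_fieldOfFlux hM c hd]

/-- Tested with the field of flux `1` out of `T` and into `T'` through the shared facet. The factor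
is a quotient of facet weights; that it is positive is all that is used. -/
theorem pressure_neighbour {i : M.Sub} {T T' : M.Cell i} {k k' : Fin (M.dim i + 1)}
    (h : M.InteriorPair i T k T' k') : ∃ r : ℝ, 0 < r ∧ q i T' = r * q i T := by
  classical
  set f₁ : M.Facet := ⟨i, T, k⟩ with hf₁
  set f₂ : M.Facet := ⟨i, T', k'⟩ with hf₂
  have hp : FacetPair f₁ f₂ := ⟨i, T, k, T', k', rfl, rfl, h⟩
  have hnot : ∀ f : M.Facet, (∀ f', ¬ FacetPair f f') → f ≠ f₁ ∧ f ≠ f₂ := fun f hf =>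
    ⟨by rintro rfl; exact hf _ hp, by rintro rfl; exact hf _ hp.symm⟩
  have hsum := sum_flux_eq_zero hM hq (c := fun f => (if f = f₁ then 1 else 0) -
      (if f = f₂ then 1 else 0)) ?_ ?_ ?_
  · simp only [sub_mul, ite_mul, one_mul, zero_mul, Finset.sum_sub_distrib, Finset.sum_ite_eq',
      Finset.mem_univ, if_true] at hsum
    have h1 : 0 < facetWeight f₁ := facetWeight_pos h.1 T k
    have h2 : 0 < facetWeight f₂ := facetWeight_pos h.1 T' k'
    refine ⟨facetWeight f₁ / facetWeight f₂, by positivity, ?_⟩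
    field_simp
    simp only [hf₁, hf₂] at hsum ⊢
    linarith
  · intro f f' hff
    have e1 : f = f₁ ↔ f' = f₂ :=
      ⟨fun e => by subst e; exact hff.unique hM hp, fun e => by
        subst e; exact hff.symm.unique hM hp.symm⟩
    have e2 : f = f₂ ↔ f' = f₁ :=
      ⟨fun e => by subst e; exact hff.unique hM hp.symm, fun e => by
        subst e; exact hff.symm.unique hM hp⟩
    simp only [e1, e2]
    ring
  · intro j S l ho _
    obtain ⟨h1, h2⟩ := hnot ⟨j, S, l⟩ (by
      rintro f' ⟨i', S', l', S'', l'', hf, -, hpair⟩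
      obtain rfl : j = i' := congrArg Sigma.fst hf
      obtain ⟨rfl, rfl⟩ := Prod.mk.inj (eq_of_heq (Sigma.mk.inj hf).2)
      exact ho.2.2 _ _ hpair)
    simp only [h1, h2, if_false, sub_zero]
  · intro j S l hΓ
    obtain ⟨h1, h2⟩ := hnot ⟨j, S, l⟩ (by
      rintro f' ⟨i', S', l', S'', l'', hf, -, hpair⟩
      obtain rfl : j = i' := congrArg Sigma.fst hf
      obtain ⟨rfl, rfl⟩ := Prod.mk.inj (eq_of_heq (Sigma.mk.inj hf).2)
      exact hpair.2.2.2 hΓ)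
    simp only [h1, h2, if_false, sub_zero]

/-- On each subdomain the pressures of any two elements agree up to a positive factor. -/
theorem pressure_proportional {i : M.Sub} (T T' : M.Cell i) :
    ∃ r : ℝ, 0 < r ∧ q i T' = r * q i T := by
  induction hM.sub_connected i T T' with
  | refl => exact ⟨1, one_pos, (one_mul _).symm⟩
  | tail _ h ih =>
    obtain ⟨r, hr, hr'⟩ := ih
    obtain ⟨k, k', hp⟩ := h
    obtain ⟨r', h0, h1⟩ := pressure_neighbour hM hq hp
    exact ⟨r' * r, mul_pos h0 hr, by rw [h1, hr', mul_assoc]⟩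

theorem pressure_eq_zero_of_eq_zero {i : M.Sub} {T : M.Cell i} (h : q i T = 0) : q i = 0 := by
  funext T'
  obtain ⟨r, -, hr⟩ := pressure_proportional hM hq T T'
  rw [hr, h, mul_zero]
  rfl

/-- A unit flux through this facet alone is admissible, and only the pressure of `T` is seen by it.
-/
theorem pressure_dirichlet {i : M.Sub} {T : M.Cell i} {k : Fin (M.dim i + 1)}
    (h : M.DirichletFacet i T k) : q i = 0 := by
  classical
  set f₁ : M.Facet := ⟨i, T, k⟩ with hf₁
  have hnp : ∀ f', ¬ FacetPair f₁ f' := by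
    rintro f' ⟨i', S', l', S'', l'', hf, -, hpair⟩
    obtain rfl : i = i' := congrArg Sigma.fst hf
    obtain ⟨rfl, rfl⟩ := Prod.mk.inj (eq_of_heq (Sigma.mk.inj hf).2)
    exact h.1.2.2 _ _ hpair
  have hsum := sum_flux_eq_zero hM hq (c := fun f => if f = f₁ then 1 else 0) ?_ ?_ ?_
  · simp only [ite_mul, one_mul, zero_mul, Finset.sum_ite_eq', Finset.mem_univ, if_true] at hsum
    have h1 : 0 < facetWeight f₁ := facetWeight_pos h.1.1 T k
    exact pressure_eq_zero_of_eq_zero hM hq ((mul_eq_zero.1 hsum).resolve_right h1.ne')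
  · intro f f' hff
    have e1 : f ≠ f₁ := by rintro rfl; exact hnp _ hff
    have e2 : f' ≠ f₁ := by rintro rfl; exact hnp _ hff.symm
    simp only [e1, e2, if_false, add_zero]
  · intro j S l _ ho
    refine if_neg fun hf => ho ?_
    obtain rfl : j = i := congrArg Sigma.fst hf
    obtain ⟨rfl, rfl⟩ := Prod.mk.inj (eq_of_heq (Sigma.mk.inj hf).2)
    exact h
  · intro j S l hΓ
    refine if_neg fun hf => ?_
    obtain rfl : j = i := congrArg Sigma.fst hf
    obtain ⟨rfl, rfl⟩ := Prod.mk.inj (eq_of_heq (Sigma.mk.inj hf).2)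
    exact h.1.2.1 hΓ

end Kernel

end MeshData

/-! ### Transfer of vanishing pressures across interfaces. -/

namespace MeshData

variable {n : ℕ} {M : MeshData n}

open Classical in
/-- The mortar function that is `1` on the interface `g` and `0` on the others. -/
def ifaceIndicator (g : M.Iface) : M.Lh := fun g' _ => if g' = g then 1 else 0

theorem ifaceIndicator_nonneg (g g' : M.Iface) (m : M.MCell g') : 0 ≤ ifaceIndicator g g' m := by
  unfold ifaceIndicator
  split_ifs <;> norm_num

theorem OnGamma.exists_inIface (hM : M.IsMesh) {i : M.Sub} {T : M.Cell i}
    {k : Fin (M.dim i + 1)} (h : M.OnGamma i T k) :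
    ∃ (g : M.Iface) (T' : M.Cell (M.upper g)) (k' : Fin (M.dim (M.upper g) + 1)),
      (⟨i, T, k⟩ : M.Facet) = ⟨M.upper g, T', k'⟩ ∧ M.InIface g T' k' := by
  obtain ⟨j, hj, hf⟩ := h
  obtain ⟨g, ⟨rfl, rfl, hn⟩, -⟩ := hM.iface_complete i j T k hj hf
  exact ⟨g, T, k, rfl, hf, hn.symm⟩

theorem measureReal_facet_pos (hM : M.IsMesh) (g : M.Iface) (T : M.Cell (M.upper g))
    (k : Fin (M.dim (M.upper g) + 1)) :
    0 < (μHE[M.dim (M.lower g)]).real (facet (M.cell _ T) k) :=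
  ENNReal.toReal_pos (measure_facet_pos _ (hM.dim_upper g) k).ne'
    (measure_facet_lt_top _ (hM.dim_upper g) k).ne

/-- A set of positive measure in an interface meets the mortar elements in positive measure. -/
theorem sum_measureReal_inter_mortar_pos (hM : M.IsMesh) (g : M.Iface) {S : Set (E n)}
    (hS : S ⊆ M.region (M.lower g)) (h0 : 0 < μHE[M.dim (M.lower g)] S) :
    0 < ∑ m, (μHE[M.dim (M.lower g)]).real (S ∩ (M.mcell g m).closedInterior) := by
  have hfin : ∀ m, μHE[M.dim (M.lower g)] (S ∩ (M.mcell g m).closedInterior) ≠ ⊤ := fun m =>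
    ((measure_mono Set.inter_subset_right).trans_lt (measure_closedInterior_lt_top _)).ne
  refine Finset.sum_pos' (fun m _ => measureReal_nonneg) ?_
  by_contra! hne
  have h1 : ∀ m, μHE[M.dim (M.lower g)] (S ∩ (M.mcell g m).closedInterior) = 0 := by
    intro m
    have h := le_antisymm (hne m (Finset.mem_univ m)) measureReal_nonneg
    rwa [measureReal_def, ENNReal.toReal_eq_zero_iff, or_iff_left (hfin m)] at h
  have h2 : S = ⋃ m, S ∩ (M.mcell g m).closedInterior := by
    rw [← Set.inter_iUnion, hM.mortar_cover g, Set.inter_eq_left.2 hS]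
  rw [h2] at h0
  exact h0.ne' (measure_iUnion_null h1)

section Extension

variable (hM : M.IsMesh) {R : M.Lh →ₗ[ℝ] M.Vh} (hR : M.IsExtension R)

include hM hR

open Classical in
/-- Testing the projection property of the extension operator with traces. -/
theorem extension_test (μ : M.Lh) {c : M.Facet → ℝ}
    (hc : ∀ i T k, ¬ M.OnGamma i T k → c ⟨i, T, k⟩ = 0) :
    (∑ g, ∑ T, ∑ k, if M.InIface g T k then M.flux (R μ) _ T k * c ⟨M.upper g, T, k⟩ *
      (μHE[M.dim (M.lower g)]).real (facet (M.cell _ T) k) else 0) =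
    ∑ g, ∑ T, ∑ k, if M.InIface g T k then ∑ m, μ g m * c ⟨M.upper g, T, k⟩ *
      (μHE[M.dim (M.lower g)]).real (facet (M.cell _ T) k ∩ (M.mcell g m).closedInterior)
      else 0 := by
  have hd : ∀ g, 0 < M.dim (M.upper g) := fun g => by rw [hM.dim_upper g]; lia
  have h := (hR μ).1 _ (fieldOfFlux_mem_Vh_of_onGamma hM hc)
  simp only [traceTrace, mortarTrace, flux_fieldOfFlux hM c (hd _)] at h
  exact h

/-- Since traces are free, the projection averages the indicator facet by facet, which preserves
sign and support. The averages are not computed: a test with the unwanted part of the flux suffices.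
-/
theorem flux_extension_indicator (g : M.Iface) {i : M.Sub} {T : M.Cell i}
    {k : Fin (M.dim i + 1)} (h : M.OnGamma i T k) :
    0 ≤ M.flux (R (ifaceIndicator g)) i T k ∧
      (i ≠ M.upper g → M.flux (R (ifaceIndicator g)) i T k = 0) := by
  classical
  set F : M.Facet → ℝ := fun f => M.flux (R (ifaceIndicator g)) f.1 f.2.1 f.2.2 with hF
  -- The negative part of the flux on `upper g` and the whole flux elsewhere: the trace side of the
  -- test is then nonnegative and the mortar side nonpositive, so every term vanishes.
  set c : M.Facet → ℝ := fun f => if M.OnGamma f.1 f.2.1 f.2.2 then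
    (if f.1 = M.upper g then min (F f) 0 else F f) else 0 with hc
  have htest := extension_test hM hR (ifaceIndicator g) (c := c) fun i T k hn => if_neg hn
  have hcF : ∀ f, 0 ≤ F f * c f := by
    intro f
    simp only [hc]
    split_ifs
    · rcases le_total (F f) 0 with h0 | h0
      · rw [min_eq_left h0]; exact mul_self_nonneg _
      · rw [min_eq_right h0, mul_zero]
    · exact mul_self_nonneg _
    · rw [mul_zero]
  have hle : ∀ g' T k, (if M.InIface g' T k then ∑ m, ifaceIndicator g g' m *
      c ⟨M.upper g', T, k⟩ * (μHE[M.dim (M.lower g')]).real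
        (facet (M.cell _ T) k ∩ (M.mcell g' m).closedInterior) else 0) ≤ 0 := by
    intro g' T k
    split_ifs with hin
    · refine Finset.sum_nonpos fun m _ => mul_nonpos_of_nonpos_of_nonneg ?_ measureReal_nonneg
      by_cases hg : g' = g
      · subst hg
        refine mul_nonpos_of_nonneg_of_nonpos (ifaceIndicator_nonneg _ _ _) ?_
        simp only [hc, if_true]
        split_ifs
        · exact min_le_right _ _
        · exact le_rfl
      · simp [ifaceIndicator, hg]
    · exact le_rfl
  have hge : ∀ g' T k, 0 ≤ (if M.InIface g' T k then
      F ⟨M.upper g', T, k⟩ * c ⟨M.upper g', T, k⟩ *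
      (μHE[M.dim (M.lower g')]).real (facet (M.cell _ T) k) else 0) := by
    intro g' T k
    split_ifs
    · exact mul_nonneg (hcF _) measureReal_nonneg
    · exact le_rfl
  have hzero := le_antisymm (htest.le.trans (Finset.sum_nonpos fun g' _ =>
    Finset.sum_nonpos fun T _ => Finset.sum_nonpos fun k _ => hle g' T k))
    (Finset.sum_nonneg fun g' _ => Finset.sum_nonneg fun T _ =>
      Finset.sum_nonneg fun k _ => hge g' T k)
  rw [Finset.sum_eq_zero_iff_of_nonneg fun g' _ => Finset.sum_nonneg fun T _ =>
      Finset.sum_nonneg fun k _ => hge g' T k] at hzero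
  have hprod : F ⟨i, T, k⟩ * c ⟨i, T, k⟩ = 0 := by
    obtain ⟨g', T', k', hf, hin⟩ := h.exists_inIface hM
    rw [hf]
    have h1 := (Finset.sum_eq_zero_iff_of_nonneg fun T _ =>
      Finset.sum_nonneg fun k _ => hge g' T k).1 (hzero g' (Finset.mem_univ _)) T'
      (Finset.mem_univ _)
    have h2 := (Finset.sum_eq_zero_iff_of_nonneg fun k _ => hge g' T' k).1 h1 k'
      (Finset.mem_univ _)
    rw [if_pos hin] at h2
    exact (mul_eq_zero.1 h2).resolve_right (measureReal_facet_pos hM g' T' k').ne'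
  have hci : c ⟨i, T, k⟩ = if i = M.upper g then min (F ⟨i, T, k⟩) 0 else F ⟨i, T, k⟩ := if_pos h
  rw [hci] at hprod
  change 0 ≤ F ⟨i, T, k⟩ ∧ (i ≠ M.upper g → F ⟨i, T, k⟩ = 0)
  by_cases hi : i = M.upper g
  · rw [if_pos hi] at hprod
    refine ⟨?_, fun hn => absurd hi hn⟩
    by_contra! hneg
    rw [min_eq_left hneg.le] at hprod
    exact hneg.ne (mul_self_eq_zero.1 hprod)
  · rw [if_neg hi] at hprod
    have h0 := mul_self_eq_zero.1 hprod
    exact ⟨h0.ge, fun _ => h0⟩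

/-- Tested with the constant trace `1`, the indicator has positive integral over `g`, so some flux
of its extension is positive. -/
theorem exists_flux_extension_pos (g : M.Iface) : ∃ f : M.Facet, f.1 = M.upper g ∧
    M.OnGamma f.1 f.2.1 f.2.2 ∧ 0 < M.flux (R (ifaceIndicator g)) f.1 f.2.1 f.2.2 := by
  classical
  have htest := extension_test hM hR (ifaceIndicator g)
    (c := fun f => if M.OnGamma f.1 f.2.1 f.2.2 then 1 else 0) fun i T k hn => if_neg hn
  have hge : ∀ g' T k, 0 ≤ (if M.InIface g' T k then ∑ m, ifaceIndicator g g' m *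
      (if M.OnGamma (M.upper g') T k then 1 else 0) * (μHE[M.dim (M.lower g')]).real
        (facet (M.cell _ T) k ∩ (M.mcell g' m).closedInterior) else 0) := by
    intro g' T k
    split_ifs
    · exact Finset.sum_nonneg fun m _ => mul_nonneg (mul_nonneg (ifaceIndicator_nonneg _ _ _)
        zero_le_one) measureReal_nonneg
    · exact Finset.sum_nonneg fun m _ => by simp
    · exact le_rfl
  obtain ⟨T₀⟩ := hM.cell_nonempty (M.lower g)
  obtain ⟨x₀, hx₀⟩ := (M.cell _ T₀).nonempty_closedInterior
  have hx : x₀ ∈ M.region (M.lower g) := Set.mem_iUnion.2 ⟨T₀, hx₀⟩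
  rw [← hM.iface_cover g] at hx
  simp only [Set.mem_iUnion] at hx
  obtain ⟨T, k, hin, -⟩ := hx
  have hpos : 0 < ∑ g', ∑ T, ∑ k, (if M.InIface g' T k then ∑ m, ifaceIndicator g g' m *
      (if M.OnGamma (M.upper g') T k then 1 else 0) * (μHE[M.dim (M.lower g')]).real
        (facet (M.cell _ T) k ∩ (M.mcell g' m).closedInterior) else 0) := by
    refine Finset.sum_pos' (fun g' _ => Finset.sum_nonneg fun T _ =>
      Finset.sum_nonneg fun k _ => hge g' T k) ⟨g, Finset.mem_univ _, ?_⟩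
    refine Finset.sum_pos' (fun T _ => Finset.sum_nonneg fun k _ => hge g T k)
      ⟨T, Finset.mem_univ _, ?_⟩
    refine Finset.sum_pos' (fun k _ => hge g T k) ⟨k, Finset.mem_univ _, ?_⟩
    rw [if_pos hin, if_pos (hin.onGamma hM)]
    simp only [ifaceIndicator, if_true, one_mul]
    exact sum_measureReal_inter_mortar_pos hM g hin.1
      (measure_facet_pos _ (hM.dim_upper g) k)
  rw [← htest] at hpos
  obtain ⟨g', -, h1⟩ := Finset.exists_lt_of_sum_lt (s := Finset.univ) (f := fun _ => (0 : ℝ))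
    (by simpa using hpos)
  obtain ⟨T', -, h2⟩ := Finset.exists_lt_of_sum_lt (s := Finset.univ) (f := fun _ => (0 : ℝ))
    (by simpa using h1)
  obtain ⟨k', -, h3⟩ := Finset.exists_lt_of_sum_lt (s := Finset.univ) (f := fun _ => (0 : ℝ))
    (by simpa using h2)
  by_cases hin' : M.InIface g' T' k'
  · rw [if_pos hin', if_pos (hin'.onGamma hM)] at h3
    have h4 := pos_of_mul_pos_left h3 measureReal_nonneg
    refine ⟨⟨M.upper g', T', k'⟩, ?_, hin'.onGamma hM, h4⟩
    by_contra hne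
    exact h4.ne' ((flux_extension_indicator hM hR g (hin'.onGamma hM)).2 hne)
  · rw [if_neg hin'] at h3
    exact absurd h3 (lt_irrefl _)

/-- The balance of the pressures on the two sides of an interface. -/
theorem exists_iface_balance {q : M.Qh} (hq : ∀ r, b R r q = 0) (g : M.Iface) :
    ∃ u : M.Facet → ℝ, (∀ f, 0 ≤ u f) ∧ (∀ f, f.1 ≠ M.upper g → u f = 0) ∧
      (∃ f, f.1 = M.upper g ∧ 0 < u f) ∧
      ∑ f, u f * q f.1 f.2.1 = ∑ T, q (M.lower g) T * ∑ m, (μHE[M.dim (M.lower g)]).real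
        ((M.cell _ T).closedInterior ∩ (M.mcell g m).closedInterior) := by
  classical
  set μ := ifaceIndicator g with hμ
  set F : M.Facet → ℝ := fun f => M.flux (R μ) f.1 f.2.1 f.2.2 with hF
  -- This element of `V_{0h}` cancels the extension off the interfaces, so the total flux lives on
  -- interface facets only. It is admissible because the extension vanishes on outer facets.
  set c : M.Facet → ℝ := fun f => if M.OnGamma f.1 f.2.1 f.2.2 then 0 else -F f with hc
  have hmem : fieldOfFlux hM c ∈ M.V0h := by
    refine fieldOfFlux_mem_V0h hM ?_ (fun i T k ho _ => ?_) fun i T k hΓ => if_pos hΓ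
    · rintro _ _ ⟨i, T, k, T', k', rfl, rfl, h⟩
      have h1 := (R μ).2.2.1 i T k T' k' h
      simp only [hc, if_neg h.2.2.2, if_neg h.symm.2.2.2, hF]
      linarith
    · simp only [hc, if_neg ho.2.1, hF, (hR μ).2 i T k ho, neg_zero]
  have h := hq (⟨_, hmem⟩, μ)
  rw [b_eq hM, neg_eq_zero] at h
  refine ⟨fun f => if M.OnGamma f.1 f.2.1 f.2.2 then F f * facetWeight f else 0, ?_, ?_, ?_, ?_⟩
  · rintro ⟨i, T, k⟩
    dsimp only
    split_ifs with hΓ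
    · exact mul_nonneg (flux_extension_indicator hM hR g hΓ).1 (facetWeight_pos hΓ.dim_pos T k).le
    · exact le_rfl
  · rintro ⟨i, T, k⟩ hi
    dsimp only
    split_ifs with hΓ
    · rw [show F ⟨i, T, k⟩ = 0 from (flux_extension_indicator hM hR g hΓ).2 hi, zero_mul]
    · rfl
  · obtain ⟨⟨i, T, k⟩, hi, hΓ, hpos⟩ := exists_flux_extension_pos hM hR g
    refine ⟨⟨i, T, k⟩, hi, ?_⟩
    dsimp only at hΓ ⊢
    rw [if_pos hΓ]
    exact mul_pos hpos (facetWeight_pos hΓ.dim_pos T k)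
  · have hjump : jumpPairing q μ = -∑ T, q (M.lower g) T * ∑ m, (μHE[M.dim (M.lower g)]).real
        ((M.cell _ T).closedInterior ∩ (M.mcell g m).closedInterior) := by
      rw [jumpPairing, Finset.sum_eq_single g]
      · simp only [hμ, ifaceIndicator, if_true, mul_one, Finset.mul_sum]
      · intro g' _ hg
        simp [hμ, ifaceIndicator, hg]
      · exact fun hn => absurd (Finset.mem_univ g) hn
    rw [hjump, add_neg_eq_zero] at h
    rw [← h]
    refine Finset.sum_congr rfl ?_
    rintro ⟨i, T, k⟩ -
    simp only [Params.total, flux_add]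
    rcases Nat.eq_zero_or_pos (M.dim i) with hd | hd
    · simp [facetWeight, hd]
    · rw [flux_fieldOfFlux hM c hd]
      simp only [hc, hF]
      split_ifs
      · ring
      · ring

/-- In each subdomain all pressures have one sign, so a nonnegative combination that is not trivial
vanishes only if all of them do. The balance equates such combinations on the two sides. -/
theorem pressure_iface {q : M.Qh} (hq : ∀ r, b R r q = 0) (g : M.Iface) :
    q (M.lower g) = 0 ↔ q (M.upper g) = 0 := by
  obtain ⟨u, hu0, hu1, ⟨⟨i, T₀, k₀⟩, hi, hpos⟩, hbal⟩ := exists_iface_balance hM hR hq g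
  dsimp only at hi
  subst hi
  constructor
  · intro hl
    simp only [hl, Pi.zero_apply, zero_mul, Finset.sum_const_zero] at hbal
    -- Multiplying by one pressure of the subdomain turns the common sign into nonnegativity of
    -- every term.
    have hnn : ∀ f ∈ (Finset.univ : Finset M.Facet),
        0 ≤ u f * q f.1 f.2.1 * q (M.upper g) T₀ := by
      rintro ⟨i, T, k⟩ -
      by_cases hi : i = M.upper g
      · subst hi
        obtain ⟨r, hr, hr'⟩ := pressure_proportional hM hq T₀ T
        dsimp only
        rw [hr']
        have := hu0 ⟨M.upper g, T, k⟩
        have h2 : u ⟨M.upper g, T, k⟩ * (r * q (M.upper g) T₀) * q (M.upper g) T₀ =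
          u ⟨M.upper g, T, k⟩ * r * (q (M.upper g) T₀) ^ 2 := by ring
        rw [h2]
        positivity
      · rw [hu1 ⟨i, T, k⟩ hi, zero_mul, zero_mul]
    have h0 : ∑ f, u f * q f.1 f.2.1 * q (M.upper g) T₀ = 0 := by
      rw [← Finset.sum_mul, hbal, zero_mul]
    have h1 := (Finset.sum_eq_zero_iff_of_nonneg hnn).1 h0 ⟨M.upper g, T₀, k₀⟩ (Finset.mem_univ _)
    rw [mul_assoc, mul_eq_zero, mul_self_eq_zero] at h1
    exact pressure_eq_zero_of_eq_zero hM hq (h1.resolve_left hpos.ne')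
  · intro hup
    have hl : ∑ f, u f * q f.1 f.2.1 = 0 := by
      refine Finset.sum_eq_zero ?_
      rintro ⟨i, T, k⟩ -
      by_cases hi : i = M.upper g
      · subst hi
        simp [hup]
      · rw [hu1 ⟨i, T, k⟩ hi, zero_mul]
    obtain ⟨T₁⟩ := hM.cell_nonempty (M.lower g)
    have hw : ∀ T : M.Cell (M.lower g), 0 < ∑ m, (μHE[M.dim (M.lower g)]).real
        ((M.cell _ T).closedInterior ∩ (M.mcell g m).closedInterior) := fun T =>
      sum_measureReal_inter_mortar_pos hM g (fun x hx => Set.mem_iUnion.2 ⟨T, hx⟩)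
        (measure_closedInterior_pos _)
    set w := fun T : M.Cell (M.lower g) => ∑ m, (μHE[M.dim (M.lower g)]).real
        ((M.cell _ T).closedInterior ∩ (M.mcell g m).closedInterior)
    have hnn : ∀ T ∈ (Finset.univ : Finset (M.Cell (M.lower g))),
        0 ≤ q (M.lower g) T * w T * q (M.lower g) T₁ := by
      intro T _
      obtain ⟨r, hr, hr'⟩ := pressure_proportional hM hq T₁ T
      have := hw T
      have h2 : q (M.lower g) T * w T * q (M.lower g) T₁ =
        r * w T * q (M.lower g) T₁ ^ 2 := by rw [hr']; ring
      rw [h2]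
      have h3 : 0 < w T := this
      positivity
    have h0 : ∑ T, q (M.lower g) T * w T * q (M.lower g) T₁ = 0 := by
      rw [← Finset.sum_mul, ← hbal, hl, zero_mul]
    have h1 := (Finset.sum_eq_zero_iff_of_nonneg hnn).1 h0 T₁ (Finset.mem_univ _)
    have h3 : 0 < w T₁ := hw T₁
    refine pressure_eq_zero_of_eq_zero hM hq (T := T₁) ?_
    by_contra hne
    refine hne (mul_self_eq_zero.1 ((mul_eq_zero.1 (?_ : w T₁ * _ = 0)).resolve_left h3.ne'))
    rw [← h1]
    ring

/-- A pressure that is orthogonal to all the divergences vanishes. -/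
theorem eq_zero_of_b_eq_zero {q : M.Qh} (hq : ∀ r, b R r q = 0) : q = 0 := by
  obtain ⟨i₀, T₀, k₀, hD⟩ := hM.dirichlet
  have h0 := pressure_dirichlet hM hq hD
  have hiff : ∀ i j, Relation.EqvGen (fun i j => ∃ g, M.lower g = i ∧ M.upper g = j) i j →
      (q i = 0 ↔ q j = 0) := by
    intro i j h
    induction h with
    | rel i j h =>
      obtain ⟨g, rfl, rfl⟩ := h
      exact pressure_iface hM hR hq g
    | refl => exact Iff.rfl
    | symm _ _ _ ih => exact ih.symm
    | trans _ _ _ _ _ ih₁ ih₂ => exact ih₁.trans ih₂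
  funext i
  exact (hiff i₀ i (hM.connected i₀ i)).1 h0

end Extension

end MeshData

/-! ### The abstract composite form. -/

section SaddlePoint

variable {W : Type*} [AddCommGroup W] [Module ℝ W] {a aD : LinearMap.BilinForm ℝ W}

theorem abs_apply_le_sqrt_mul_sqrt (h0 : ∀ r, 0 ≤ a r r) (hs : ∀ w r, a w r = a r w) (w r : W) :
    |a w r| ≤ √(a w w) * √(a r r) := by
  rw [← Real.sqrt_mul (h0 w)]
  exact Real.abs_le_sqrt (a.apply_sq_le_of_symm h0 ⟨fun x y => (hs x y)⟩ w r)

/-- Continuity of the composite form. -/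
theorem abs_saddle_le {C : ℝ} (hC : 0 ≤ C) (h0 : ∀ r, 0 ≤ a r r) (hs : ∀ w r, a w r = a r w)
    (hD0 : ∀ r, 0 ≤ aD r r) (hDs : ∀ w r, aD w r = aD r w) (hle : ∀ r, aD r r ≤ C * a r r)
    (w r x y : W) :
    |a w r + aD x r + aD y w| ≤
      (1 + 2 * √C) * √(a w w + aD x x) * √(a r r + aD y y) := by
  have hr : √(aD r r) ≤ √C * √(a r r) := by
    rw [← Real.sqrt_mul hC]; exact Real.sqrt_le_sqrt (hle r)
  have hw : √(aD w w) ≤ √C * √(a w w) := by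
    rw [← Real.sqrt_mul hC]; exact Real.sqrt_le_sqrt (hle w)
  set Nx := √(a w w + aD x x)
  set Ny := √(a r r + aD y y)
  have h1 : √(a w w) ≤ Nx := Real.sqrt_le_sqrt (by linarith [hD0 x])
  have h2 : √(a r r) ≤ Ny := Real.sqrt_le_sqrt (by linarith [hD0 y])
  have h3 : √(aD x x) ≤ Nx := Real.sqrt_le_sqrt (by linarith [h0 w])
  have h4 : √(aD y y) ≤ Ny := Real.sqrt_le_sqrt (by linarith [h0 r])
  have e1 : |a w r| ≤ Nx * Ny :=
    (abs_apply_le_sqrt_mul_sqrt h0 hs w r).trans (by gcongr)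
  -- The norm controls `r` through `a` only, so passing to `aD` costs the factor `√C`.
  have e2 : |aD x r| ≤ Nx * (√C * Ny) :=
    (abs_apply_le_sqrt_mul_sqrt hD0 hDs x r).trans
      (mul_le_mul h3 (hr.trans (by gcongr)) (Real.sqrt_nonneg _) (Real.sqrt_nonneg _))
  have e3 : |aD y w| ≤ Ny * (√C * Nx) :=
    (abs_apply_le_sqrt_mul_sqrt hD0 hDs y w).trans
      (mul_le_mul h4 (hw.trans (by gcongr)) (Real.sqrt_nonneg _) (Real.sqrt_nonneg _))
  calc |a w r + aD x r + aD y w| ≤ |a w r| + |aD x r| + |aD y w| := abs_add_three _ _ _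
    _ ≤ Nx * Ny + Nx * (√C * Ny) + Ny * (√C * Nx) := by gcongr
    _ = _ := by ring

/-- Stability of the composite form, with the test function `(r + y / 4, -q)`, where `y` is the
gradient of `q`. -/
theorem le_saddle (h0 : ∀ r, 0 ≤ a r r) (hs : ∀ w r, a w r = a r w)
    (hD0 : ∀ r, 0 ≤ aD r r) (hle : ∀ r, a r r ≤ 4 * aD r r)
    (r y : W) :
    1 / 16 * (√(a (r + (1 / 4 : ℝ) • y) (r + (1 / 4 : ℝ) • y) + aD (-y) (-y)) *
        √(a r r + aD y y)) ≤
      a (r + (1 / 4 : ℝ) • y) r + aD (-y) r + aD y (r + (1 / 4 : ℝ) • y) := by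
  -- `h1` bounds the cross term below, so the right-hand side is at least `a r r / 2 + aD y y / 8`;
  -- `h2` bounds it above, so the norm of the test pair is at most twice that of `(r, y)`. The
  -- quotient of `1/8` and `2` is `1/16`.
  have h1 := h0 (r + (1 / 4 : ℝ) • y)
  have h2 := h0 (r - (1 / 4 : ℝ) • y)
  have h3 := hle y
  have hr := h0 r
  have hy := hD0 y
  have hN : 0 ≤ a r r + aD y y := add_nonneg hr hy
  simp only [map_add, map_sub, map_smul, LinearMap.add_apply, LinearMap.sub_apply,
    LinearMap.smul_apply, smul_eq_mul, hs y r] at h1 h2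
  have hx : √(a (r + (1 / 4 : ℝ) • y) (r + (1 / 4 : ℝ) • y) + aD (-y) (-y)) ≤
      2 * √(a r r + aD y y) := by
    rw [show (2 : ℝ) = √(2 ^ 2) from (Real.sqrt_sq (by norm_num)).symm,
      ← Real.sqrt_mul (by norm_num)]
    refine Real.sqrt_le_sqrt ?_
    simp only [map_add, map_smul, map_neg, LinearMap.add_apply, LinearMap.smul_apply,
      LinearMap.neg_apply, smul_eq_mul, hs y r, neg_neg]
    linarith
  have hmul := mul_le_mul_of_nonneg_right hx (Real.sqrt_nonneg (a r r + aD y y))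
  rw [mul_assoc, Real.mul_self_sqrt hN] at hmul
  simp only [map_add, map_smul, map_neg, LinearMap.add_apply, LinearMap.smul_apply,
    LinearMap.neg_apply, smul_eq_mul, hs y r] at hmul ⊢
  linarith

end SaddlePoint

/-! ### The discrete gradient and definiteness of the weighted norm. -/

namespace MeshData

variable {n : ℕ} {M : MeshData n}

theorem rtDiv_add (d : ℕ) {D : Submodule ℝ (E n)} (v w : D × ℝ) :
    rtDiv d (v + w) = rtDiv d v + rtDiv d w := by
  simp only [rtDiv, Prod.snd_add, mul_add]

theorem rtDiv_smul (d : ℕ) {D : Submodule ℝ (E n)} (c : ℝ) (v : D × ℝ) :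
    rtDiv d (c • v) = c * rtDiv d v := by
  simp only [rtDiv, Prod.smul_snd, smul_eq_mul]
  ring

/-- The form `b` as a linear map from `Q_h` to the dual of `W_h`. -/
def bForm (R : M.Lh →ₗ[ℝ] M.Vh) : M.Qh →ₗ[ℝ] Module.Dual ℝ M.Wh :=
  LinearMap.mk₂ ℝ (fun q r => b R r q)
    (fun q q' r => by
      simp only [b, jumpPairing, Pi.add_apply, add_mul, Finset.sum_add_distrib]; ring)
    (fun c q r => by
      simp only [b, jumpPairing, Pi.smul_apply, smul_eq_mul, mul_neg, mul_add, Finset.mul_sum,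
        mul_assoc])
    (fun q r r' => by
      simp only [b, jumpPairing, Params.total_add, Pi.add_apply, rtDiv_add, Prod.snd_add, mul_add,
        add_mul, Finset.sum_add_distrib]; ring)
    (fun c q r => by
      simp only [b, jumpPairing, Params.total_smul, Pi.smul_apply, rtDiv_smul, Prod.smul_snd,
        smul_eq_mul, mul_neg, mul_add, Finset.mul_sum, mul_assoc, mul_left_comm c])

namespace Params

variable {P : M.Params} {R : M.Lh →ₗ[ℝ] M.Vh}

theorem eq_of_forall_aD (hM : M.IsMesh) {w w' : M.Wh} (h : ∀ r, P.aD R w r = P.aD R w' r) :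
    w = w' := by
  rw [← sub_eq_zero]
  refine eq_zero_of_aD_self (P := P) (R := R) hM ?_
  have h1 := h (w - w')
  rw [← aDForm_apply, ← aDForm_apply, ← sub_eq_zero, ← LinearMap.sub_apply, ← map_sub] at h1
  exact h1

/-- Definiteness makes `aD` an injection of `W_h` into its dual, hence an isomorphism by dimension;
the gradient is its inverse after `bForm`. -/
theorem existsUnique_discreteGradient (P : M.Params) (hM : M.IsMesh) (R : M.Lh →ₗ[ℝ] M.Vh) :
    ∃! G : M.Qh →ₗ[ℝ] M.Wh, P.IsDiscreteGradient R G := by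
  have hinj : Function.Injective (P.aDForm R : M.Wh →ₗ[ℝ] Module.Dual ℝ M.Wh) := fun w w' h =>
    eq_of_forall_aD (P := P) (R := R) hM fun r => LinearMap.congr_fun h r
  let e := LinearEquiv.ofInjectiveOfFinrankEq (P.aDForm R : M.Wh →ₗ[ℝ] Module.Dual ℝ M.Wh) hinj
    Subspace.dual_finrank_eq.symm
  refine ⟨e.symm.toLinearMap.comp (bForm R), fun p r => ?_, fun G hG => ?_⟩
  · exact LinearMap.congr_fun (e.apply_symm_apply (bForm R p)) r
  · refine LinearMap.ext fun p => eq_of_forall_aD (P := P) (R := R) hM fun r => ?_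
    rw [hG p r]
    exact (LinearMap.congr_fun (e.apply_symm_apply (bForm R p)) r).symm

/-- Definiteness of `a` comes from that of `aD` by the lumping bound with some anisotropy; for the
pressure, `G q = 0` makes `q` orthogonal to all divergences. -/
theorem weightedNorm_pos {σ : ℝ} (hM : M.IsMesh) (hσ : M.ShapeRegular σ) (hR : M.IsExtension R)
    {G : M.Qh →ₗ[ℝ] M.Wh} (hG : P.IsDiscreteGradient R G) {y : M.Wh × M.Qh} (hy : y ≠ 0) :
    0 < P.weightedNorm R G y := by
  have h1 := a_self_nonneg (P := P) (R := R) hM y.1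
  have h2 := aD_self_nonneg (P := P) (R := R) hM (G y.2)
  refine Real.sqrt_pos.2 (lt_of_le_of_ne (add_nonneg h1 h2) fun h => hy ?_)
  obtain ⟨κ, hκ⟩ := P.exists_anisotropyLE
  have h3 : P.a R y.1 y.1 = 0 := by linarith
  have h4 : P.aD R (G y.2) (G y.2) = 0 := by linarith
  have h5 := aD_self_le (R := R) hM hσ hκ y.1
  rw [h3, mul_zero] at h5
  have h6 : y.1 = 0 := eq_zero_of_aD_self (P := P) (R := R) hM
    (le_antisymm h5 (aD_self_nonneg hM y.1))
  have h7 : G y.2 = 0 := eq_zero_of_aD_self (P := P) (R := R) hM h4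
  refine Prod.ext h6 (eq_zero_of_b_eq_zero hM hR fun r => ?_)
  rw [← hG y.2 r, h7, ← aDForm_apply, map_zero, LinearMap.zero_apply]

end Params

end MeshData

end MixedDim

end

/-! ### Assembly of the stability theorem. -/

open MixedDim MixedDim.MeshData in
theorem mainTheorem1 (n : ℕ) (hn : n = 2 ∨ n = 3) (σ : ℝ) :
    ∃ β : ℝ, 0 < β ∧ ∀ κ : ℝ, ∃ α : ℝ, 0 < α ∧
      ∀ (M : MixedDim.MeshData n), M.IsMesh → M.ShapeRegular σ →
      ∀ (P : M.Params) (R : M.Lh →ₗ[ℝ] M.Vh), M.IsExtension R →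
        (∃! G : M.Qh →ₗ[ℝ] M.Wh, P.IsDiscreteGradient R G) ∧
        ∀ G : M.Qh →ₗ[ℝ] M.Wh, P.IsDiscreteGradient R G →
          (P.AnisotropyLE κ → ∀ x y : M.Wh × M.Qh,
            |P.compositeForm R G x y| ≤ α * P.weightedNorm R G x * P.weightedNorm R G y) ∧
          (β : EReal) ≤ ⨅ (y : M.Wh × M.Qh) (_ : y ≠ 0), ⨆ (x : M.Wh × M.Qh) (_ : x ≠ 0),
            ((P.compositeForm R G x y / (P.weightedNorm R G x * P.weightedNorm R G y) : ℝ) :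
              EReal) := by
  refine ⟨1 / 16, by norm_num, fun κ => ⟨1 + 2 * √(Params.lumpingBound n σ κ), by positivity,
    fun M hM hσ P R hR => ⟨P.existsUnique_discreteGradient hM R, fun G hG => ⟨?_, ?_⟩⟩⟩⟩
  · intro hκ x y
    exact abs_saddle_le (a := P.aForm R) (aD := P.aDForm R) (Params.lumpingBound_pos n σ κ).le
      (fun r => Params.a_self_nonneg hM r) (P.a_comm R) (fun r => Params.aD_self_nonneg hM r)
      (P.aD_comm R) (fun r => Params.aD_self_le hM hσ hκ r) x.1 y.1 (G x.2) (G y.2)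
  · refine le_iInf₂ fun y hy => ?_
    -- The dimension enters the stability constant only here, through `n + 1 ≤ 4`.
    have hle : ∀ r : M.Wh, P.a R r r ≤ 4 * P.aD R r r := fun r => by
      have h1 := Params.a_self_le (P := P) (R := R) hM r
      have h2 := Params.aD_self_nonneg (P := P) (R := R) hM r
      have h3 : (n : ℝ) ≤ 3 := by exact_mod_cast (by lia : n ≤ 3)
      nlinarith
    have hmain := le_saddle (a := P.aForm R) (aD := P.aDForm R)
      (fun r => Params.a_self_nonneg hM r) (P.a_comm R) (fun r => Params.aD_self_nonneg hM r)
      hle y.1 (G y.2)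
    -- The supremum is bounded below by its value at the test pair of `le_saddle`.
    set x : M.Wh × M.Qh := (y.1 + (1 / 4 : ℝ) • G y.2, -y.2) with hx
    have hx0 : x ≠ 0 := by
      intro h
      have h2 : y.2 = 0 := neg_eq_zero.1 (congrArg Prod.snd h)
      have h1 : y.1 + (1 / 4 : ℝ) • G y.2 = 0 := congrArg Prod.fst h
      rw [h2, map_zero, smul_zero, add_zero] at h1
      exact hy (Prod.ext h1 h2)
    refine le_iSup₂_of_le x hx0 (EReal.coe_le_coe_iff.2 ?_)
    -- A vanishing denominator would give the quotient the value `0`, so both norms must be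
    -- positive.
    rw [le_div_iff₀ (mul_pos (Params.weightedNorm_pos hM hσ hR hG hx0)
      (Params.weightedNorm_pos hM hσ hR hG hy))]
    rw [← map_neg] at hmain
    exact hmain
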